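/- Let $n\ge 2$ and let $\Omega$ be a smooth connected $n$-dimensional manifold (Hausdorff, $\sigma$-compact, without boundary; for instance a domain of $\mathbb R^n$). Let $\nu$ be a positive measure on $\Omega$ which, in local coordinates, has a density with respect to Lebesgue measure that is locally bounded above and locally bounded below by a positive constant. For every $x\in\Omega$ let $A(x)$ be a symmetric positive definite matrix (a positive definite quadratic form on the cotangent space at $x$), measurable in $x$, locally bounded and locally uniformly elliptic in local coordinates, and write $|\xi|_A^2=\langle \xi,A(x)\xi\rangle$. Let $L=-\operatorname{div}(A\nabla\,\cdot)$, where $-\operatorname{div}$ is the formal adjoint of $\nabla$ with respect to $\nu$ (so $L\mathbf 1=0$), and denote also by $L$ its Friedrichs extension, i.e. the self-adjoint operator on $L^2(\Omega,d\nu)$ (complex-valued functions) associated with the closure of the quadratic form $q(u)=\int_\Omega\langle A\nabla u,\nabla u\rangle\,d\nu$, $u\in C_0^\infty(\Omega)$. Limits as $x\to\infty$ are taken with respect to the point at infinity of the one-point compactification of $\Omega$. Let $K\subset\Omega$ be compact, $\alpha\in(0,1)$, and let $v\in C^{1,\alpha}_{loc}(\Omega\setminus K)$ be a real function such that, for some constant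 $C>0$, $$\lim_{x\to\infty}|\nabla v(x)|_A=C,\qquad \lim_{x\to\infty}v(x)=+\infty,$$ and such that $Lv=f$ in the weak sense on $\Omega\setminus K$, that is $\int\langle A\nabla v,\nabla\zeta\rangle\,d\nu=\int f\zeta\,d\nu$ for all $\zeta\in C_0^\infty(\Omega\setminus K)$, for some $f\in L^\infty_{loc}(\Omega\setminus K)$ with $\lim_{x\to\infty}f(x)=0$. Let $\chi=v_\star\nu$ be the push-forward by $v$ of the restriction of $\nu$ to $\Omega\setminus K$, restricted to $[0,\infty)$. Assume that $\chi$ is absolutely continuous with respect to Lebesgue measure, that it has infinite mass, and that it has subexponential volume growth, i.e. $$\limsup_{r\to\infty}\frac1r\log\chi([0,r])=0.$$ Then the spectrum of $L$ is $[0,\infty)$. Moreover, for every $\eta\ge0$ there is a sequence $(\varphi_k)_{k\in\mathbb N}$ of compactly supported complex-valued functions of class $C^{1,\alpha}_{loc}$ on $\Omega$, non-zero in $L^2(\Omega,d\nu)$ and belonging to the domain of $L$, such that $$\lim_{k\to\infty}\frac{\|(L-\eta)\varphi_k\|_2}{\|\varphi_k\|_2}=0,$$ and such that for every compact $K'\subset\Omega$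 there is $N$ with $\operatorname{supp}\varphi_k\subset\Omega\setminus K'$ for all $k\ge N$. Furthermore, for every $m\in\{0,1,2,\dots\}\cup\{\infty\}$, if $v$ is of class $C^m$ on $\Omega\setminus K$ then all the $\varphi_k$ are of class $C^m$ (in particular they are smooth if $v$ is). -/

import Mathlib

open MeasureTheory Filter
open scoped Manifold ContDiff Topology NNReal

noncomputable section

namespace DivForm

/-- The differential `du(x)`, a covector at `x`, of a real function on a manifold. -/
def differential {n : ℕ} {M : Type*} [TopologicalSpace M]
    [ChartedSpace (EuclideanSpace ℝ (Fin n)) M] (u : M → ℝ) (x : M) :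
    TangentSpace 𝓘(ℝ, EuclideanSpace ℝ (Fin n)) x →L[ℝ] ℝ :=
  mfderiv 𝓘(ℝ, EuclideanSpace ℝ (Fin n)) 𝓘(ℝ, ℝ) u x

/-- The coefficient `A` of the operator `-div (A ∇ ·)`: for every point `x`, the quadratic form
`ξ ↦ ⟨ξ, A(x) ξ⟩` on covectors, given by its polar form `(ξ, ζ) ↦ ⟨ξ, A(x) ζ⟩`. -/
abbrev CoeffField (n : ℕ) (M : Type*) [TopologicalSpace M]
    [ChartedSpace (EuclideanSpace ℝ (Fin n)) M] : Type _ :=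
  ∀ x : M, LinearMap.BilinForm ℝ (TangentSpace 𝓘(ℝ, EuclideanSpace ℝ (Fin n)) x →L[ℝ] ℝ)

/-- The covector at `y` whose components are `ξ` in the preferred chart around `x₀`,
that is `∑ i, ξ i • dyⁱ` where `yⁱ` are the coordinates of that chart. -/
def coordCovector {n : ℕ} {M : Type*} [TopologicalSpace M]
    [ChartedSpace (EuclideanSpace ℝ (Fin n)) M] (x₀ y : M)
    (ξ : EuclideanSpace ℝ (Fin n) →L[ℝ] ℝ) :
    TangentSpace 𝓘(ℝ, EuclideanSpace ℝ (Fin n)) y →L[ℝ] ℝ :=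
  ξ.comp (mfderiv 𝓘(ℝ, EuclideanSpace ℝ (Fin n)) 𝓘(ℝ, EuclideanSpace ℝ (Fin n))
    (extChartAt 𝓘(ℝ, EuclideanSpace ℝ (Fin n)) x₀) y)

/-- In local coordinates the measure `ν` has a density with respect to Lebesgue measure that is
locally bounded from above and locally bounded from below by a positive constant. -/
def HasLocallyBoundedDensity {n : ℕ} {M : Type*} [TopologicalSpace M]
    [ChartedSpace (EuclideanSpace ℝ (Fin n)) M] [MeasurableSpace M] (ν : Measure M) : Prop :=
  ∀ x₀ : M, ∃ U ∈ 𝓝 x₀, ∃ a b : ℝ≥0, 0 < a ∧ ∀ B ⊆ U, MeasurableSet B →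
    a * volume (extChartAt 𝓘(ℝ, EuclideanSpace ℝ (Fin n)) x₀ '' B) ≤ ν B ∧
    ν B ≤ b * volume (extChartAt 𝓘(ℝ, EuclideanSpace ℝ (Fin n)) x₀ '' B)

/-- `A` is symmetric, positive definite at every point, and, in local coordinates, measurable,
locally bounded and locally uniformly elliptic. -/
structure IsElliptic {n : ℕ} {M : Type*} [TopologicalSpace M]
    [ChartedSpace (EuclideanSpace ℝ (Fin n)) M] [MeasurableSpace M] (ν : Measure M)
    (A : CoeffField n M) : Prop where
  symm : ∀ x ξ ζ, A x ξ ζ = A x ζ ξ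
  posDef : ∀ x ξ, ξ ≠ 0 → 0 < A x ξ ξ
  measurable : ∀ (x₀ : M) (ξ ζ : EuclideanSpace ℝ (Fin n) →L[ℝ] ℝ),
    AEMeasurable (fun y => A y (coordCovector x₀ y ξ) (coordCovector x₀ y ζ))
      (ν.restrict (chartAt (EuclideanSpace ℝ (Fin n)) x₀).source)
  bounds : ∀ x₀ : M, ∃ U ∈ 𝓝 x₀, ∃ a b : ℝ, 0 < a ∧
    ∀ y ∈ U, ∀ ξ : EuclideanSpace ℝ (Fin n) →L[ℝ] ℝ,
      a * ‖ξ‖ ^ 2 ≤ A y (coordCovector x₀ y ξ) (coordCovector x₀ y ξ) ∧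
      A y (coordCovector x₀ y ξ) (coordCovector x₀ y ξ) ≤ b * ‖ξ‖ ^ 2

/-- `|∇u(x)|_A`. -/
def gradNorm {n : ℕ} {M : Type*} [TopologicalSpace M]
    [ChartedSpace (EuclideanSpace ℝ (Fin n)) M] (A : CoeffField n M) (u : M → ℝ) (x : M) : ℝ :=
  Real.sqrt (A x (differential u x) (differential u x))

/-- `u` is of class `C^{1,α}_loc` on the open set `U`. -/
def IsC1HolderOn {n : ℕ} {M : Type*} [TopologicalSpace M]
    [ChartedSpace (EuclideanSpace ℝ (Fin n)) M] {F : Type*} [NormedAddCommGroup F]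
    [NormedSpace ℝ F] (α : ℝ≥0) (u : M → F) (U : Set M) : Prop :=
  ContMDiffOn 𝓘(ℝ, EuclideanSpace ℝ (Fin n)) 𝓘(ℝ, F) 1 u U ∧
  ∀ x ∈ U, ∃ W ∈ 𝓝 (extChartAt 𝓘(ℝ, EuclideanSpace ℝ (Fin n)) x x), ∃ C : ℝ≥0,
    HolderOnWith C α
      (fderiv ℝ (u ∘ (extChartAt 𝓘(ℝ, EuclideanSpace ℝ (Fin n)) x).symm)) W

/-- The test functions `C_0^∞(U)` with values in `F`, for an open set `U`. -/
def IsTestFunction (n : ℕ) {M : Type*} [TopologicalSpace M]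
    [ChartedSpace (EuclideanSpace ℝ (Fin n)) M] {F : Type*} [NormedAddCommGroup F]
    [NormedSpace ℝ F] (U : Set M) (ζ : M → F) : Prop :=
  ContMDiff 𝓘(ℝ, EuclideanSpace ℝ (Fin n)) 𝓘(ℝ, F) ∞ ζ ∧ HasCompactSupport ζ ∧ tsupport ζ ⊆ U

/-- The polarized quadratic form `q(u, w) = ∫ ⟨A ∇u, ∇w⟩ dν` on real functions. -/
def form {n : ℕ} {M : Type*} [TopologicalSpace M]
    [ChartedSpace (EuclideanSpace ℝ (Fin n)) M] [MeasurableSpace M] (ν : Measure M)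
    (A : CoeffField n M) (u w : M → ℝ) : ℝ :=
  ∫ x, A x (differential u x) (differential w x) ∂ν

/-- `f ∈ L^∞_loc(U)`, for an open set `U`. -/
def IsLocallyEssBounded {M : Type*} [TopologicalSpace M] [MeasurableSpace M] (ν : Measure M)
    (U : Set M) (f : M → ℝ) : Prop :=
  AEStronglyMeasurable f (ν.restrict U) ∧
  ∀ x ∈ U, ∃ V ∈ 𝓝 x, ∃ B : ℝ, ∀ᵐ y ∂(ν.restrict V), |f y| ≤ B

/-- `-div (A ∇u) = f` in the weak sense on the open set `U`, with `f ∈ L^∞_loc(U)`. -/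
def IsWeakSolutionOn {n : ℕ} {M : Type*} [TopologicalSpace M]
    [ChartedSpace (EuclideanSpace ℝ (Fin n)) M] [MeasurableSpace M] (ν : Measure M)
    (A : CoeffField n M) (U : Set M) (u f : M → ℝ) : Prop :=
  IsLocallyEssBounded ν U f ∧
  ∀ ζ : M → ℝ, IsTestFunction n U ζ → form ν A u ζ = ∫ x, f x * ζ x ∂ν

/-- The quadratic form of the complexified operator, `q(u) = q(Re u) + q(Im u)`. -/
def energy {n : ℕ} {M : Type*} [TopologicalSpace M]
    [ChartedSpace (EuclideanSpace ℝ (Fin n)) M] [MeasurableSpace M] (ν : Measure M)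
    (A : CoeffField n M) (u : M → ℂ) : ℝ :=
  form ν A (fun x => (u x).re) (fun x => (u x).re) +
    form ν A (fun x => (u x).im) (fun x => (u x).im)

/-- The complex-bilinear form `q(u, ζ)` of a complex function `u` and a real function `ζ`. -/
def complexForm {n : ℕ} {M : Type*} [TopologicalSpace M]
    [ChartedSpace (EuclideanSpace ℝ (Fin n)) M] [MeasurableSpace M] (ν : Measure M)
    (A : CoeffField n M) (u : M → ℂ) (ζ : M → ℝ) : ℂ :=
  (form ν A (fun x => (u x).re) ζ : ℂ) + Complex.I * (form ν A (fun x => (u x).im) ζ : ℂ)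

/-- The sequence `w` of complex test functions converges to `u` in `L²(ν)` and is Cauchy for the
quadratic form. The functions `u` that have such a sequence make up the domain of the closure
of `q`, and the closed form satisfies `q(u, ζ) = lim q(w k, ζ)`. -/
def FormConverges {n : ℕ} {M : Type*} [TopologicalSpace M]
    [ChartedSpace (EuclideanSpace ℝ (Fin n)) M] [MeasurableSpace M] (ν : Measure M)
    (A : CoeffField n M) (w : ℕ → M → ℂ) (u : M → ℂ) : Prop :=
  (∀ k, IsTestFunction n Set.univ (w k)) ∧
  Tendsto (fun k => eLpNorm (w k - u) 2 ν) atTop (𝓝 0) ∧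
  ∀ ε : ℝ, 0 < ε → ∃ N, ∀ k ≥ N, ∀ l ≥ N, energy ν A (w k - w l) < ε

/-- The graph of the Friedrichs extension `L` of `-div (A ∇ ·)` on `L²(ν; ℂ)`: the function `u`
lies in the domain of `L`, and `L u = f`. This is the self-adjoint operator associated with the
closure of the quadratic form on `C_0^∞`: `u` is in the domain of the closed form, `f` is in
`L²(ν)` and `q(u, ζ) = ∫ f ζ dν` for all test functions `ζ` (real ones suffice by linearity). -/
def FriedrichsGraph {n : ℕ} {M : Type*} [TopologicalSpace M]
    [ChartedSpace (EuclideanSpace ℝ (Fin n)) M] [MeasurableSpace M] (ν : Measure M)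
    (A : CoeffField n M) (u f : M → ℂ) : Prop :=
  MemLp u 2 ν ∧ MemLp f 2 ν ∧
  ∃ w : ℕ → M → ℂ, FormConverges ν A w u ∧
    ∀ ζ : M → ℝ, IsTestFunction n Set.univ ζ →
      Tendsto (fun k => complexForm ν A (w k) ζ) atTop (𝓝 (∫ x, f x * (ζ x : ℂ) ∂ν))

/-- The resolvent set of the Friedrichs extension `L`: `L - z`, from the domain of `L`
to `L²(ν; ℂ)`, has a bounded everywhere defined inverse `R`. -/
def resolventSet {n : ℕ} {M : Type*} [TopologicalSpace M]
    [ChartedSpace (EuclideanSpace ℝ (Fin n)) M] [MeasurableSpace M] (ν : Measure M)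
    (A : CoeffField n M) : Set ℂ :=
  {z | ∃ R : Lp ℂ 2 ν →L[ℂ] Lp ℂ 2 ν,
    (∀ f : Lp ℂ 2 ν, FriedrichsGraph ν A (R f) (f + z • R f : Lp ℂ 2 ν)) ∧
    ∀ u g : Lp ℂ 2 ν, FriedrichsGraph ν A u g → R (g - z • u) = u}

/-- The spectrum of the Friedrichs extension. -/
def spectrum {n : ℕ} {M : Type*} [TopologicalSpace M]
    [ChartedSpace (EuclideanSpace ℝ (Fin n)) M] [MeasurableSpace M] (ν : Measure M)
    (A : CoeffField n M) : Set ℂ :=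
  (resolventSet ν A)ᶜ

/-- The class `𝒞` of positive measures on `[0, ∞)` that are absolutely continuous with respect to
Lebesgue measure and have infinite mass. -/
structure IsClassC (χ : Measure ℝ) : Prop where
  supported : χ (Set.Iio 0) = 0
  absolutelyContinuous : χ ≪ volume
  infinite : χ Set.univ = ⊤

/-- The exponential rate of volume growth `limsup_{r → ∞} (1 / r) log V(r)`, where
`V(r) = χ [0, r]`. -/
def growthRate (χ : Measure ℝ) : EReal :=
  limsup (fun r : ℝ => ((r⁻¹ : ℝ) : EReal) * ENNReal.log (χ (Set.Icc 0 r))) atTop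

/-- The measure `v_* ν` on `[0, ∞)`, for a function `v` defined outside `K`. -/
def pushforward {M : Type*} [MeasurableSpace M] (ν : Measure M) (K : Set M) (v : M → ℝ) :
    Measure ℝ :=
  (Measure.map v (ν.restrict Kᶜ)).restrict (Set.Ici 0)

end DivForm

end

namespace DivForm

/-! ### Differentials and the coefficient `A` in charts -/

section Coordinates

variable {n : ℕ} {M : Type*} [TopologicalSpace M] [ChartedSpace (EuclideanSpace ℝ (Fin n)) M]

/-! The half-line `[0, ∞)` lies in the spectrum because functions of `v` behave at infinity like
functions of one real variable. If `L v = f`, then `L (h ∘ v) = h'(v) f - h''(v) |∇v|²`. Far out,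
`f` is close to `0` and `|∇v|²` to `C²`, so `L` acts on such functions almost as `-C² d²/dr²`. Given
`η ≥ 0`, put `λ = √η / C` and `h(r) = ψ(r) exp(iλr)` with a real cutoff `ψ` that varies slowly on a
scale `l`. Then `h'' + λ² h` is of size `1 / l`, and `(L - η)(h ∘ v)` is uniformly small.

This pointwise bound must be compared with the `L²` norm of `h ∘ v`. The error lives on the shell
`{R ≤ v ≤ S}`, whereas `|h ∘ v| = 1` is guaranteed only on `{R + l ≤ v ≤ S - l}`. Here the volume
growth enters: if the mass of `[R, R + jl]` more than doubled at every late step, it would grow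
exponentially. So some step does not double it, and since the total mass is infinite the loss at the
lower end is negligible as well; the two masses differ by a factor of at most 4
(`exists_measure_Icc_le_four_mul`). The resulting functions form a Weyl sequence, and a bounded
inverse of `L - η` would contradict it (`notMem_resolventSet_of_tendsto`).

Two points need care. First, `h ∘ v` is only `C¹`, so it has to be shown to lie in the form domain,
and the weak equation has to be tested with the `C¹` function `h'(v) ζ`. Both follow from
approximation by smooth functions in the `C¹` sense, by mollification in charts and a partition of
unity (`exists_isSmoothLimit`). Second, `v` is controlled only off `K`, so `h ∘ v` is cut off on a
compact neighbourhood `K₁` of `K`; with `R` above the values of `v` on the boundary of `K₁`, this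
creates no discontinuity.

For the reverse inclusion, complete the test functions in the form norm and let `J` be the map from
the completion to `L²`. Then `T = J J*` is `(1 + L)⁻¹`, and its numerical range lies in `[0, 1]`.
For `z` outside `[0, ∞)` the operator `1 - (1 + z) T` is coercive, hence invertible, and `(1 - (1 +
z) T)⁻¹ T` inverts `L - z`. -/

theorem contDiffOn_comp_extChartAt_symm [IsManifold (𝓡 n) ∞ M] {F : Type*} [NormedAddCommGroup F]
    [NormedSpace ℝ F] {m : ℕ∞} {U : Set M} {u : M → F}
    (hu : ContMDiffOn (𝓡 n) 𝓘(ℝ, F) m u U) (x₀ : M) :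
    ContDiffOn ℝ m (u ∘ (extChartAt (𝓡 n) x₀).symm)
      ((extChartAt (𝓡 n) x₀).target ∩ (extChartAt (𝓡 n) x₀).symm ⁻¹' U) := by
  have : IsManifold (𝓡 n) (m : ℕ∞ω) M := IsManifold.of_le (n := ∞) (by exact_mod_cast le_top)
  rw [← contMDiffOn_iff_contDiffOn]
  exact hu.comp ((contMDiffOn_extChartAt_symm x₀).mono Set.inter_subset_left) fun y hy => hy.2

theorem isOpen_extChartAt_target_inter_preimage (x₀ : M) {U : Set M} (hU : IsOpen U) :
    IsOpen ((extChartAt (𝓡 n) x₀).target ∩ (extChartAt (𝓡 n) x₀).symm ⁻¹' U) :=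
  (continuousOn_extChartAt_symm x₀).isOpen_inter_preimage (isOpen_extChartAt_target x₀) hU

/-- The chain rule for `u = (u ∘ chart⁻¹) ∘ chart`. It brings intrinsic differentials into the form
in which ellipticity and measurability of `A` are stated. -/
theorem differential_eq_coordCovector [IsManifold (𝓡 n) ∞ M] {x₀ y : M}
    (hy : y ∈ (chartAt (EuclideanSpace ℝ (Fin n)) x₀).source) {u : M → ℝ}
    (hu : MDifferentiableAt (𝓡 n) 𝓘(ℝ, ℝ) u y) :
    differential u y = coordCovector x₀ y
      (fderiv ℝ (u ∘ (extChartAt (𝓡 n) x₀).symm) (extChartAt (𝓡 n) x₀ y)) := by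
  have hy' : y ∈ (extChartAt (𝓡 n) x₀).source := by rwa [extChartAt_source]
  have hz : extChartAt (𝓡 n) x₀ y ∈ (extChartAt (𝓡 n) x₀).target :=
    (extChartAt (𝓡 n) x₀).map_source hy'
  have hsymm : MDifferentiableAt 𝓘(ℝ, EuclideanSpace ℝ (Fin n)) (𝓡 n)
      (extChartAt (𝓡 n) x₀).symm (extChartAt (𝓡 n) x₀ y) :=
    (mdifferentiableOn_extChartAt_symm _ hz).mdifferentiableAt
      ((isOpen_extChartAt_target x₀).mem_nhds hz)
  have hcomp : MDifferentiableAt 𝓘(ℝ, EuclideanSpace ℝ (Fin n)) 𝓘(ℝ, ℝ)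
      (u ∘ (extChartAt (𝓡 n) x₀).symm) (extChartAt (𝓡 n) x₀ y) := by
    refine MDifferentiableAt.comp _ ?_ hsymm
    rwa [(extChartAt (𝓡 n) x₀).left_inv hy']
  have heq : (u ∘ (extChartAt (𝓡 n) x₀).symm) ∘ extChartAt (𝓡 n) x₀ =ᶠ[𝓝 y] u := by
    filter_upwards [(isOpen_extChartAt_source x₀).mem_nhds hy'] with z hz
    exact congrArg u ((extChartAt (𝓡 n) x₀).left_inv hz)
  rw [differential, coordCovector, ← heq.mfderiv_eq,
    mfderiv_comp y hcomp (mdifferentiableAt_extChartAt hy), mfderiv_eq_fderiv]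
  rfl

theorem coordCovector_sum {ι : Type*} (s : Finset ι) (x₀ y : M) (c : ι → ℝ)
    (ξ : ι → EuclideanSpace ℝ (Fin n) →L[ℝ] ℝ) :
    coordCovector x₀ y (∑ i ∈ s, c i • ξ i) = ∑ i ∈ s, c i • coordCovector x₀ y (ξ i) := by
  have hz : coordCovector x₀ y (0 : EuclideanSpace ℝ (Fin n) →L[ℝ] ℝ) = 0 :=
    ContinuousLinearMap.zero_comp _
  have ha (a b : EuclideanSpace ℝ (Fin n) →L[ℝ] ℝ) :
      coordCovector x₀ y (a + b) = coordCovector x₀ y a + coordCovector x₀ y b :=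
    ContinuousLinearMap.add_comp _ _ _
  have hm (r : ℝ) (a : EuclideanSpace ℝ (Fin n) →L[ℝ] ℝ) :
      coordCovector x₀ y (r • a) = r • coordCovector x₀ y a :=
    ContinuousLinearMap.smul_comp _ _ _
  induction s using Finset.cons_induction with
  | empty => simp [hz]
  | cons i s hi ih => rw [Finset.sum_cons, Finset.sum_cons, ← ih, ha, hm]

theorem differential_eq_zero_of_notMem_tsupport {u : M → ℝ} {x : M}
    (hx : x ∉ tsupport u) :
    differential (n := n) u x = 0 := by
  have h : u =ᶠ[𝓝 x] fun _ => (0 : ℝ) := notMem_tsupport_iff_eventuallyEq.1 hx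
  exact h.mfderiv_eq.trans (mfderiv_const (I := 𝓡 n))

variable [MeasurableSpace M]

theorem IsElliptic.nonneg {ν : Measure M} {A : CoeffField n M} (hA : IsElliptic ν A) (x : M)
    (ξ : TangentSpace (𝓡 n) x →L[ℝ] ℝ) : 0 ≤ A x ξ ξ := by
  by_cases h : ξ = 0
  · simp [h]
  · exact (hA.posDef x ξ h).le

theorem IsElliptic.sq_le {ν : Measure M} {A : CoeffField n M} (hA : IsElliptic ν A) (x : M)
    (ξ ζ : TangentSpace (𝓡 n) x →L[ℝ] ℝ) : A x ξ ζ ^ 2 ≤ A x ξ ξ * A x ζ ζ :=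
  LinearMap.BilinForm.apply_sq_le_of_symm (A x) (hA.nonneg x) ⟨fun ξ ζ => hA.symm x ξ ζ⟩ ξ ζ

theorem IsElliptic.abs_le {ν : Measure M} {A : CoeffField n M} (hA : IsElliptic ν A) (x : M)
    (ξ ζ : TangentSpace (𝓡 n) x →L[ℝ] ℝ) :
    |A x ξ ζ| ≤ √(A x ξ ξ) * √(A x ζ ζ) := by
  rw [← Real.sqrt_mul (hA.nonneg x ξ)]
  exact Real.abs_le_sqrt (hA.sq_le x ξ ζ)

theorem IsElliptic.add_le {ν : Measure M} {A : CoeffField n M} (hA : IsElliptic ν A) (x : M)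
    (ξ ζ : TangentSpace (𝓡 n) x →L[ℝ] ℝ) :
    A x (ξ + ζ) (ξ + ζ) ≤ 2 * A x ξ ξ + 2 * A x ζ ζ := by
  have h := hA.nonneg x (ξ - ζ)
  simp only [map_sub, map_add, LinearMap.sub_apply, LinearMap.add_apply] at h ⊢
  linarith

/-- A small neighbourhood is mapped by the chart into a ball of radius one, so the upper density
bound makes its measure finite. -/
theorem HasLocallyBoundedDensity.isLocallyFiniteMeasure [BorelSpace M] {ν : Measure M}
    (hν : HasLocallyBoundedDensity (n := n) ν) : IsLocallyFiniteMeasure ν := by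
  refine ⟨fun x₀ => ?_⟩
  obtain ⟨U, hU, a, b, -, h⟩ := hν x₀
  have hcont := (continuousAt_extChartAt (I := 𝓡 n) x₀).preimage_mem_nhds
    (Metric.ball_mem_nhds (extChartAt (𝓡 n) x₀ x₀) one_pos)
  obtain ⟨V, hV, hVo, hxV⟩ := mem_nhds_iff.1 (Filter.inter_mem hU hcont)
  refine ⟨V, hVo.mem_nhds hxV, ?_⟩
  refine ((h V (hV.trans Set.inter_subset_left) hVo.measurableSet).2).trans_lt ?_
  refine ENNReal.mul_lt_top (by simp) (lt_of_le_of_lt (measure_mono ?_)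
    (measure_ball_lt_top (x := extChartAt (𝓡 n) x₀ x₀) (r := 1)))
  rintro _ ⟨y, hy, rfl⟩
  exact (hV hy).2

theorem IsElliptic.exists_nhds_bound [IsManifold (𝓡 n) ∞ M] {ν : Measure M} {A : CoeffField n M}
    (hA : IsElliptic ν A) {u : M → ℝ} {U : Set M} (hU : IsOpen U)
    (hu : ContMDiffOn (𝓡 n) 𝓘(ℝ, ℝ) 1 u U) {x₀ : M} (hx₀ : x₀ ∈ U) :
    ∃ W ∈ 𝓝 x₀, ∃ B : ℝ, ∀ y ∈ W, A y (differential u y) (differential u y) ≤ B := by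
  obtain ⟨V, hV, a, b, -, h⟩ := hA.bounds x₀
  have hO := isOpen_extChartAt_target_inter_preimage (n := n) x₀ hU
  have hcd : ContDiffOn ℝ 1 _ _ := contDiffOn_comp_extChartAt_symm (m := 1) hu x₀
  have hmem : extChartAt (𝓡 n) x₀ x₀ ∈ (extChartAt (𝓡 n) x₀).target ∩
      (extChartAt (𝓡 n) x₀).symm ⁻¹' U := ⟨mem_extChartAt_target x₀, by simpa using hx₀⟩
  have hf := (hcd.continuousOn_fderiv_of_isOpen hO le_rfl).continuousAt (hO.mem_nhds hmem)
  have hg : ContinuousAt (fun y => ‖fderiv ℝ (u ∘ (extChartAt (𝓡 n) x₀).symm)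
      (extChartAt (𝓡 n) x₀ y)‖ ^ 2) x₀ :=
    (ContinuousAt.comp (f := extChartAt (𝓡 n) x₀) hf (continuousAt_extChartAt x₀)).norm.pow 2
  refine ⟨_, Filter.inter_mem (Filter.inter_mem hV (hg.eventually (eventually_le_nhds
    (lt_add_one _)))) (Filter.inter_mem (chart_source_mem_nhds (EuclideanSpace ℝ (Fin n)) x₀)
      (hU.mem_nhds hx₀)), |b| * (‖fderiv ℝ (u ∘ (extChartAt (𝓡 n) x₀).symm)
      (extChartAt (𝓡 n) x₀ x₀)‖ ^ 2 + 1), ?_⟩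
  rintro y ⟨⟨hyV, hy⟩, hys, hyU⟩
  rw [differential_eq_coordCovector hys
    (((hu y hyU).contMDiffAt (hU.mem_nhds hyU)).mdifferentiableAt one_ne_zero)]
  refine ((h y hyV _).2).trans ?_
  exact (mul_le_mul_of_nonneg_right (le_abs_self b) (by positivity)).trans
    (mul_le_mul_of_nonneg_left hy (abs_nonneg b))

theorem IsElliptic.exists_bound_of_isCompact [IsManifold (𝓡 n) ∞ M] {ν : Measure M}
    {A : CoeffField n M} (hA : IsElliptic ν A) {u : M → ℝ} {U S : Set M} (hU : IsOpen U)
    (hu : ContMDiffOn (𝓡 n) 𝓘(ℝ, ℝ) 1 u U) (hS : IsCompact S) (hSU : S ⊆ U) :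
    ∃ B : ℝ, 0 ≤ B ∧ ∀ y ∈ S, A y (differential u y) (differential u y) ≤ B := by
  refine hS.induction_on (p := fun S => ∃ B : ℝ, 0 ≤ B ∧ ∀ y ∈ S,
    A y (differential u y) (differential u y) ≤ B) ⟨0, le_rfl, by simp⟩ ?_ ?_ ?_
  · rintro s t hst ⟨B, hB, h⟩
    exact ⟨B, hB, fun y hy => h y (hst hy)⟩
  · rintro s t ⟨B, hB, h⟩ ⟨B', hB', h'⟩
    refine ⟨max B B', le_max_of_le_left hB, ?_⟩
    rintro y (hy | hy)
    · exact (h y hy).trans (le_max_left _ _)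
    · exact (h' y hy).trans (le_max_right _ _)
  · intro x hx
    obtain ⟨W, hW, B, h⟩ := hA.exists_nhds_bound hU hu (hSU hx)
    exact ⟨W, mem_nhdsWithin_of_mem_nhds hW, max B 0, le_max_right _ _,
      fun y hy => (h y hy).trans (le_max_left _ _)⟩

/-- In one chart the pairing is a finite sum of products of two continuous partial derivatives and
an entry of the coefficient matrix, which is a.e. measurable there by hypothesis. Countably many
charts cover `M`. -/
theorem IsElliptic.aemeasurable_pairing [SigmaCompactSpace M] [BorelSpace M]
    [IsManifold (𝓡 n) ∞ M] {ν : Measure M}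
    {A : CoeffField n M} (hA : IsElliptic ν A) {u w : M → ℝ} {U : Set M} (hU : IsOpen U)
    (hu : ContMDiffOn (𝓡 n) 𝓘(ℝ, ℝ) 1 u U) (hw : ContMDiffOn (𝓡 n) 𝓘(ℝ, ℝ) 1 w U) :
    AEMeasurable (fun y => A y (differential u y) (differential w y)) (ν.restrict U) := by
  have := ChartedSpace.secondCountable_of_sigmaCompact (EuclideanSpace ℝ (Fin n)) M
  obtain ⟨s, hs, hcov⟩ := TopologicalSpace.countable_cover_nhds
    (fun x : M => chart_source_mem_nhds (EuclideanSpace ℝ (Fin n)) x)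
  have hUe : U = ⋃ x : s, (chartAt (EuclideanSpace ℝ (Fin n)) (x : M)).source ∩ U := by
    rw [← Set.iUnion_inter, ← Set.biUnion_eq_iUnion s
      (fun x _ => (chartAt (EuclideanSpace ℝ (Fin n)) x).source), hcov, Set.univ_inter]
  have := hs.to_subtype
  rw [hUe, aemeasurable_iUnion_iff]
  rintro ⟨x₀, -⟩
  have hso : IsOpen (chartAt (EuclideanSpace ℝ (Fin n)) x₀).source := (chartAt _ x₀).open_source
  set b := (EuclideanSpace.basisFun (Fin n) ℝ).toBasis with hb
  set e : Fin n → EuclideanSpace ℝ (Fin n) →L[ℝ] ℝ := fun i => EuclideanSpace.proj i with he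
  have hdec : ∀ ξ : EuclideanSpace ℝ (Fin n) →L[ℝ] ℝ,
      ξ = ∑ i, ξ (EuclideanSpace.single i 1) • e i := by
    intro ξ
    refine ContinuousLinearMap.coe_inj.1 (b.ext fun i => ?_)
    simp [hb, he, PiLp.single_apply]
  have hmeas : ∀ (p : M → ℝ), ContMDiffOn (𝓡 n) 𝓘(ℝ, ℝ) 1 p U → ∀ i, AEMeasurable
      (fun y => fderiv ℝ (p ∘ (extChartAt (𝓡 n) x₀).symm) (extChartAt (𝓡 n) x₀ y)
        (EuclideanSpace.single i 1))
      (ν.restrict ((chartAt (EuclideanSpace ℝ (Fin n)) x₀).source ∩ U)) := by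
    intro p hp i
    refine ContinuousOn.aemeasurable ?_ (hso.inter hU).measurableSet
    have hO := isOpen_extChartAt_target_inter_preimage (n := n) x₀ hU
    have hcd : ContDiffOn ℝ 1 _ _ := contDiffOn_comp_extChartAt_symm (m := 1) hp x₀
    refine (ContinuousOn.comp (hcd.continuousOn_fderiv_of_isOpen hO le_rfl)
      ((continuousOn_extChartAt x₀).mono ?_) ?_).clm_apply continuousOn_const
    · rw [extChartAt_source]; exact Set.inter_subset_left
    · rintro y ⟨hy, hyU⟩
      rw [← extChartAt_source (𝓡 n)] at hy
      exact ⟨(extChartAt (𝓡 n) x₀).map_source hy, by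
        rwa [Set.mem_preimage, (extChartAt (𝓡 n) x₀).left_inv hy]⟩
  have key : AEMeasurable (fun y => ∑ i, ∑ j,
      fderiv ℝ (u ∘ (extChartAt (𝓡 n) x₀).symm) (extChartAt (𝓡 n) x₀ y)
        (EuclideanSpace.single i 1) *
      (fderiv ℝ (w ∘ (extChartAt (𝓡 n) x₀).symm) (extChartAt (𝓡 n) x₀ y)
        (EuclideanSpace.single j 1) *
      A y (coordCovector x₀ y (e i)) (coordCovector x₀ y (e j))))
      (ν.restrict ((chartAt (EuclideanSpace ℝ (Fin n)) x₀).source ∩ U)) := by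
    refine Finset.aemeasurable_fun_sum _ fun i _ => Finset.aemeasurable_fun_sum _ fun j _ => ?_
    refine (hmeas u hu i).mul ((hmeas w hw j).mul ?_)
    exact (hA.measurable x₀ (e i) (e j)).mono_measure
      (Measure.restrict_mono Set.inter_subset_left le_rfl)
  refine key.congr ?_
  filter_upwards [ae_restrict_mem (hso.inter hU).measurableSet] with y hy
  rw [differential_eq_coordCovector hy.1
    (((hu y hy.2).contMDiffAt (hU.mem_nhds hy.2)).mdifferentiableAt one_ne_zero),
    differential_eq_coordCovector hy.1
    (((hw y hy.2).contMDiffAt (hU.mem_nhds hy.2)).mdifferentiableAt one_ne_zero)]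
  conv_rhs =>
    rw [hdec (fderiv ℝ (u ∘ (extChartAt (𝓡 n) x₀).symm) (extChartAt (𝓡 n) x₀ y)),
      hdec (fderiv ℝ (w ∘ (extChartAt (𝓡 n) x₀).symm) (extChartAt (𝓡 n) x₀ y)),
      coordCovector_sum, coordCovector_sum]
  simp only [map_sum, LinearMap.sum_apply, map_smul, LinearMap.smul_apply, smul_eq_mul,
    Finset.mul_sum]
  rw [Finset.sum_comm]
  exact Finset.sum_congr rfl fun i _ => Finset.sum_congr rfl fun j _ => by ring

/-- Cauchy–Schwarz for `A x` bounds the integrand on the compact support of `w`. It is enough that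
`u` is `C¹` near that support, which allows `u = v` on the complement of `K`. -/
theorem IsElliptic.integrable_pairing [T2Space M] [SigmaCompactSpace M] [BorelSpace M]
    [IsManifold (𝓡 n) ∞ M] {ν : Measure M} [IsLocallyFiniteMeasure ν]
    {A : CoeffField n M} (hA : IsElliptic ν A) {u w : M → ℝ} {U : Set M} (hU : IsOpen U)
    (hu : ContMDiffOn (𝓡 n) 𝓘(ℝ, ℝ) 1 u U) (hw : ContMDiffOn (𝓡 n) 𝓘(ℝ, ℝ) 1 w U)
    (hc : HasCompactSupport w) (hs : tsupport w ⊆ U) :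
    Integrable (fun y => A y (differential u y) (differential w y)) ν := by
  obtain ⟨B, hB, h⟩ := hA.exists_bound_of_isCompact hU hu hc hs
  obtain ⟨B', hB', h'⟩ := hA.exists_bound_of_isCompact hU hw hc hs
  rw [← integrableOn_iff_integrable_of_support_subset (s := tsupport w)]
  · have : IsFiniteMeasure (ν.restrict (tsupport w)) :=
      isFiniteMeasure_restrict.2 hc.measure_lt_top.ne
    refine Integrable.of_bound (C := √B * √B') (((hA.aemeasurable_pairing hU hu hw).mono_measure
        (Measure.restrict_mono hs le_rfl)).aestronglyMeasurable) ?_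
    filter_upwards [ae_restrict_mem (isClosed_tsupport w).measurableSet] with y hy
    refine (hA.abs_le y _ _).trans ?_
    gcongr
    · exact h y hy
    · exact h' y hy
  · intro y hy
    by_contra hn
    exact hy (by simp [differential_eq_zero_of_notMem_tsupport hn])

end Coordinates

end DivForm

/-! ### Mollification in Euclidean space -/

section Mollification

/-- Convolve with a bump function of small radius. The derivative of the convolution is the
convolution with `fderiv ℝ g`, and both `g` and `fderiv ℝ g` are uniformly continuous because they
are continuous with compact support. -/
theorem exists_contDiff_C1_approx {E : Type*} [NormedAddCommGroup E] [NormedSpace ℝ E]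
    [FiniteDimensional ℝ E] {g : E → ℝ} (hg : ContDiff ℝ 1 g) (hc : HasCompactSupport g)
    {δ ε : ℝ} (hδ : 0 < δ) (hε : 0 < ε) :
    ∃ w : E → ℝ, ContDiff ℝ ∞ w ∧ tsupport w ⊆ Metric.cthickening δ (tsupport g) ∧
      ∀ x, |w x - g x| ≤ ε ∧ ‖fderiv ℝ w x - fderiv ℝ g x‖ ≤ ε := by
  borelize E
  set μ : Measure E := Measure.addHaar
  have hg' : Continuous (fderiv ℝ g) := hg.continuous_fderiv one_ne_zero
  obtain ⟨δ₁, hδ₁, h₁⟩ := Metric.uniformContinuous_iff.1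
    (hc.uniformContinuous_of_continuous hg.continuous) ε hε
  obtain ⟨δ₂, hδ₂, h₂⟩ := Metric.uniformContinuous_iff.1
    ((hc.fderiv (𝕜 := ℝ)).uniformContinuous_of_continuous hg') ε hε
  set r := min δ (min δ₁ δ₂) with hr
  have hr0 : 0 < r := lt_min hδ (lt_min hδ₁ hδ₂)
  let φ : ContDiffBump (0 : E) := ⟨r / 2, r, half_pos hr0, half_lt_self hr0⟩
  have hconv : ∀ x, HasFDerivAt (convolution (φ.normed μ) g (ContinuousLinearMap.lsmul ℝ ℝ) μ)
      (convolution (φ.normed μ) (fderiv ℝ g) (ContinuousLinearMap.lsmul ℝ ℝ) μ x) x := by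
    intro x
    have := hc.hasFDerivAt_convolution_right (f := φ.normed μ) (μ := μ)
      (ContinuousLinearMap.lsmul ℝ ℝ)
      (φ.continuous_normed.locallyIntegrable) hg x
    refine this.congr_fderiv (integral_congr_ae (Eventually.of_forall fun t => ?_))
    ext v
    rfl
  refine ⟨convolution (φ.normed μ) g (ContinuousLinearMap.lsmul ℝ ℝ) μ, ?_, ?_, ?_⟩
  · exact φ.hasCompactSupport_normed.contDiff_convolution_left _ φ.contDiff_normed
      hg.continuous.locallyIntegrable
  · refine closure_minimal ((support_convolution_subset _).trans ?_) Metric.isClosed_cthickening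
    rw [φ.support_normed_eq]
    rintro _ ⟨a, ha, b, hb, rfl⟩
    refine Metric.mem_cthickening_of_dist_le _ b _ _ (subset_tsupport _ hb) ?_
    have : ‖a‖ < r := by simpa using ha
    simpa using this.le.trans (min_le_left _ _)
  · intro x
    constructor
    · rw [← Real.dist_eq]
      refine ContDiffBump.dist_normed_convolution_le hg.continuous.aestronglyMeasurable ?_
      intro y hy
      exact (h₁ (lt_of_lt_of_le hy ((min_le_right _ _).trans (min_le_left _ _)))).le
    · rw [(hconv x).fderiv, ← dist_eq_norm]
      refine ContDiffBump.dist_normed_convolution_le hg'.aestronglyMeasurable ?_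
      intro y hy
      exact (h₂ (lt_of_lt_of_le hy ((min_le_right _ _).trans (min_le_right _ _)))).le

end Mollification

namespace DivForm

/-! ### Smooth approximation of `C¹` functions on the manifold -/

section Approximation

variable {n : ℕ} {M : Type*} [TopologicalSpace M] [ChartedSpace (EuclideanSpace ℝ (Fin n)) M]

theorem differential_add {u w : M → ℝ} {x : M} (hu : MDifferentiableAt (𝓡 n) 𝓘(ℝ, ℝ) u x)
    (hw : MDifferentiableAt (𝓡 n) 𝓘(ℝ, ℝ) w x) :
    differential (n := n) (u + w) x = differential u x + differential w x :=
  mfderiv_add hu hw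

theorem differential_sub {u w : M → ℝ} {x : M} (hu : MDifferentiableAt (𝓡 n) 𝓘(ℝ, ℝ) u x)
    (hw : MDifferentiableAt (𝓡 n) 𝓘(ℝ, ℝ) w x) :
    differential (n := n) (u - w) x = differential u x - differential w x :=
  mfderiv_sub hu hw

theorem differential_const_smul {u : M → ℝ} {x : M} (hu : MDifferentiableAt (𝓡 n) 𝓘(ℝ, ℝ) u x)
    (c : ℝ) : differential (n := n) (c • u) x = c • differential u x :=
  const_smul_mfderiv hu c

theorem differential_mul {u w : M → ℝ} {x : M} (hu : MDifferentiableAt (𝓡 n) 𝓘(ℝ, ℝ) u x)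
    (hw : MDifferentiableAt (𝓡 n) 𝓘(ℝ, ℝ) w x) :
    differential (n := n) (u * w) x = u x • differential w x + w x • differential u x :=
  (HasMFDerivAt.mul hu.hasMFDerivAt hw.hasMFDerivAt).mfderiv

/-- `φ` is a limit of smooth functions with support in `S`, uniformly together with the
differentials, measured by `A`. -/
def IsSmoothLimit (A : CoeffField n M) (φ : M → ℝ) (S : Set M) : Prop :=
  ∀ ε : ℝ, 0 < ε → ∃ w : M → ℝ, ContMDiff (𝓡 n) 𝓘(ℝ, ℝ) ∞ w ∧ tsupport w ⊆ S ∧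
    ∀ x, |w x - φ x| ≤ ε ∧ A x (differential (w - φ) x) (differential (w - φ) x) ≤ ε

variable {A : CoeffField n M}

theorem IsSmoothLimit.add [MeasurableSpace M] {ν : Measure M} (hA : IsElliptic ν A)
    {φ ψ : M → ℝ} {S T : Set M}   (hφ : ContMDiff (𝓡 n) 𝓘(ℝ, ℝ) 1 φ) (hψ : ContMDiff (𝓡 n) 𝓘(ℝ, ℝ) 1 ψ)
    (h₁ : IsSmoothLimit A φ S) (h₂ : IsSmoothLimit A ψ T) : IsSmoothLimit A (φ + ψ) (S ∪ T) := by
  intro ε hε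
  -- The share `ε / 4` absorbs the factors 2 of `IsElliptic.add_le`; for the absolute values `ε / 2`
  -- would do.
  obtain ⟨w, hw, hwS, hwφ⟩ := h₁ (ε / 4) (by positivity)
  obtain ⟨z, hz, hzT, hzψ⟩ := h₂ (ε / 4) (by positivity)
  refine ⟨w + z, hw.add hz, ?_, fun x => ⟨?_, ?_⟩⟩
  · exact (tsupport_add w z).trans (Set.union_subset_union hwS hzT)
  · have h : (w + z) x - (φ + ψ) x = (w x - φ x) + (z x - ψ x) := by
      simp only [Pi.add_apply]; ring
    rw [h]
    exact (abs_add_le _ _).trans (by linarith [(hwφ x).1, (hzψ x).1])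
  · have hwd := (hw.mdifferentiable (by simp)) x
    have hzd := (hz.mdifferentiable (by simp)) x
    have hφd := (hφ.mdifferentiable one_ne_zero) x
    have hψd := (hψ.mdifferentiable one_ne_zero) x
    have h : w + z - (φ + ψ) = (w - φ) + (z - ψ) := by ring
    rw [h, differential_add (hwd.sub hφd) (hzd.sub hψd)]
    exact (hA.add_le x _ _).trans (by linarith [(hwφ x).2, (hzψ x).2])

/-- Transport `φ` to Euclidean space by the chart, mollify there and transport back; the upper
ellipticity bound `b` converts Euclidean control of the derivative into control by `A`. The
thickening radius `δ` is fixed before `ε`, so one compact set `S` serves all approximants. -/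
theorem isSmoothLimit_of_tsupport_subset_chart [T2Space M] [IsManifold (𝓡 n) ∞ M]
    {φ : M → ℝ}   (hφ : ContMDiff (𝓡 n) 𝓘(ℝ, ℝ) 1 φ) (hc : HasCompactSupport φ) {x₀ : M} {V : Set M}
    (hV : IsOpen V) (hVs : V ⊆ (chartAt (EuclideanSpace ℝ (Fin n)) x₀).source)
    (hφV : tsupport φ ⊆ V) {b : ℝ}
    (hb : ∀ y ∈ V, ∀ ξ : EuclideanSpace ℝ (Fin n) →L[ℝ] ℝ,
      A y (coordCovector x₀ y ξ) (coordCovector x₀ y ξ) ≤ b * ‖ξ‖ ^ 2) :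
    ∃ S, IsCompact S ∧ S ⊆ V ∧ IsSmoothLimit A φ S := by
  set e := extChartAt (𝓡 n) x₀ with he
  have hsrc : e.source = (chartAt (EuclideanSpace ℝ (Fin n)) x₀).source := extChartAt_source _ _
  rw [← hsrc] at hVs
  set K₃ := e '' tsupport φ with hK₃
  have hK₃c : IsCompact K₃ :=
    hc.isCompact.image_of_continuousOn ((continuousOn_extChartAt x₀).mono (hφV.trans hVs))
  set O := e.target ∩ e.symm ⁻¹' V with hO
  have hOo : IsOpen O := isOpen_extChartAt_target_inter_preimage (n := n) x₀ hV
  have hKO : K₃ ⊆ O := by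
    rintro _ ⟨y, hy, rfl⟩
    exact ⟨e.map_source (hVs (hφV hy)), by
      rw [Set.mem_preimage, e.left_inv (hVs (hφV hy))]; exact hφV hy⟩
  obtain ⟨δ, hδ, hδO⟩ := hK₃c.exists_cthickening_subset_open hOo hKO
  set g : EuclideanSpace ℝ (Fin n) → ℝ := e.target.indicator (φ ∘ e.symm) with hg
  have hgz : Function.support g ⊆ K₃ := by
    intro z hz
    have hzt : z ∈ e.target := by
      by_contra h
      exact hz (Set.indicator_of_notMem h _)
    rw [Function.mem_support, hg, Set.indicator_of_mem hzt] at hz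
    exact ⟨e.symm z, subset_tsupport _ hz, e.right_inv hzt⟩
  have hgt : tsupport g ⊆ K₃ := closure_minimal hgz hK₃c.isClosed
  have hgc : HasCompactSupport g := hK₃c.of_isClosed_subset (isClosed_tsupport g) hgt
  have hgeq : ∀ z ∈ e.target, g =ᶠ[𝓝 z] φ ∘ e.symm := fun z hz => by
    filter_upwards [(isOpen_extChartAt_target x₀).mem_nhds hz] with y hy
    exact Set.indicator_of_mem hy _
  have hcd : ContDiffOn ℝ 1 (φ ∘ e.symm) (e.target ∩ e.symm ⁻¹' Set.univ) :=
    contDiffOn_comp_extChartAt_symm (m := 1) (U := Set.univ) hφ.contMDiffOn x₀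
  rw [Set.preimage_univ, Set.inter_univ] at hcd
  have hg1 : ContDiff ℝ 1 g := by
    rw [contDiff_iff_contDiffAt]
    intro z
    by_cases hz : z ∈ K₃
    · have hzt := (hKO hz).1
      exact (hcd.contDiffAt ((isOpen_extChartAt_target x₀).mem_nhds hzt)).congr_of_eventuallyEq
        (hgeq z hzt)
    · refine (contDiffAt_const (c := (0 : ℝ))).congr_of_eventuallyEq ?_
      exact notMem_tsupport_iff_eventuallyEq.1 fun h => hz (hgt h)
  set S := e.symm '' Metric.cthickening δ K₃ with hS
  have hSc : IsCompact S := hK₃c.cthickening.image_of_continuousOn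
    ((continuousOn_extChartAt_symm x₀).mono (hδO.trans Set.inter_subset_left))
  have hSV : S ⊆ V := by
    rintro _ ⟨z, hz, rfl⟩
    exact (hδO hz).2
  refine ⟨S, hSc, hSV, fun ε hε => ?_⟩
  -- The bound by `1` gives `ε' ^ 2 ≤ ε'`, and the bound by `ε / (|b| + 1)` gives `|b| * ε' ≤ ε`
  -- also when `b = 0`.
  set ε' := min (min ε 1) (ε / (|b| + 1)) with hε'
  have hε'0 : 0 < ε' := lt_min (lt_min hε one_pos) (by positivity)
  obtain ⟨g', hg', hg's, hgg⟩ := exists_contDiff_C1_approx hg1 hgc hδ hε'0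
  replace hg's := hg's.trans (Metric.cthickening_subset_of_subset δ hgt)
  set w : M → ℝ := e.source.indicator (g' ∘ e) with hw
  have hws : Function.support w ⊆ S := by
    intro x hx
    have hxs : x ∈ e.source := by
      by_contra h
      exact hx (Set.indicator_of_notMem h _)
    rw [Function.mem_support, hw, Set.indicator_of_mem hxs] at hx
    exact ⟨e x, hg's (subset_tsupport _ hx), e.left_inv hxs⟩
  have hwt : tsupport w ⊆ S := closure_minimal hws hSc.isClosed
  have hweq : ∀ x ∈ e.source, w =ᶠ[𝓝 x] g' ∘ e := fun x hx => by
    filter_upwards [(isOpen_extChartAt_source x₀).mem_nhds hx] with y hy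
    exact Set.indicator_of_mem hy _
  have hwsm : ContMDiff (𝓡 n) 𝓘(ℝ, ℝ) ∞ w := by
    refine contMDiff_of_tsupport fun x hx => ?_
    have hxs := hVs (hSV (hwt hx))
    refine ContMDiffAt.congr_of_eventuallyEq ?_ (hweq x hxs)
    exact hg'.contMDiff.contMDiffAt.comp x (contMDiffAt_extChartAt' (by rwa [hsrc] at hxs))
  refine ⟨w, hwsm, hwt, fun x => ?_⟩
  by_cases hxV : x ∈ V
  · have hxs := hVs hxV
    have hxt := e.map_source hxs
    constructor
    · have h1 : w x = g' (e x) := Set.indicator_of_mem hxs _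
      have h2 : φ x = g (e x) := by
        rw [hg, Set.indicator_of_mem hxt, Function.comp_apply, e.left_inv hxs]
      rw [h1, h2]
      exact (hgg _).1.trans ((min_le_left _ _).trans (min_le_left _ _))
    · have hd : MDifferentiableAt (𝓡 n) 𝓘(ℝ, ℝ) (w - φ) x :=
        ((hwsm.mdifferentiable (by simp)) x).sub ((hφ.mdifferentiable one_ne_zero) x)
      rw [differential_eq_coordCovector (by rwa [hsrc] at hxs) hd]
      refine (hb x hxV _).trans ?_
      have heq : (w - φ) ∘ e.symm =ᶠ[𝓝 (e x)] g' - g := by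
        filter_upwards [(isOpen_extChartAt_target x₀).mem_nhds hxt] with z hz
        have hz' := e.map_target hz
        simp only [Function.comp_apply, Pi.sub_apply]
        rw [hw, hg, Set.indicator_of_mem hz', Set.indicator_of_mem hz, Function.comp_apply,
          e.right_inv hz, Function.comp_apply]
      rw [heq.fderiv_eq, fderiv_sub (hg'.differentiable (by simp) _)
        (hg1.differentiable one_ne_zero _)]
      have h3 := (hgg (e x)).2
      have h4 : ‖fderiv ℝ g' (e x) - fderiv ℝ g (e x)‖ ^ 2 ≤ ε' := by
        refine (pow_le_pow_left₀ (norm_nonneg _) h3 2).trans ?_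
        have : ε' ≤ 1 := (min_le_left _ _).trans (min_le_right _ _)
        nlinarith
      calc b * ‖fderiv ℝ g' (e x) - fderiv ℝ g (e x)‖ ^ 2
          ≤ |b| * ε' := mul_le_mul (le_abs_self b) h4 (by positivity) (abs_nonneg b)
        _ ≤ |b| * (ε / (|b| + 1)) := by gcongr; exact min_le_right _ _
        _ ≤ (|b| + 1) * (ε / (|b| + 1)) := by gcongr; linarith
        _ = ε := by field_simp
  · have h1 : x ∉ tsupport w := fun h => hxV (hSV (hwt h))
    have h2 : x ∉ tsupport φ := fun h => hxV (hφV h)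
    have h3 : x ∉ tsupport (w - φ) := fun h => by
      rcases tsupport_sub w φ h with h | h
      exacts [h1 h, h2 h]
    rw [image_eq_zero_of_notMem_tsupport h1, image_eq_zero_of_notMem_tsupport h2,
      differential_eq_zero_of_notMem_tsupport h3]
    simp [hε.le]

/-- A partition of unity on the support splits `φ` into finitely many pieces, each supported in a
chart on which the ellipticity bound is uniform; each piece is approximated separately. -/
theorem exists_isSmoothLimit [T2Space M] [SigmaCompactSpace M] [IsManifold (𝓡 n) ∞ M]
    [MeasurableSpace M] {ν : Measure M} (hA : IsElliptic ν A) {φ : M → ℝ}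
    (hφ : ContMDiff (𝓡 n) 𝓘(ℝ, ℝ) 1 φ) (hc : HasCompactSupport φ) {U : Set M} (hU : IsOpen U)
    (hφU : tsupport φ ⊆ U) :
    ∃ S, IsCompact S ∧ S ⊆ U ∧ tsupport φ ⊆ S ∧ IsSmoothLimit A φ S := by
  have hloc : ∀ x : tsupport φ, ∃ V : Set M, IsOpen V ∧ (x : M) ∈ V ∧ V ⊆ U ∧
      V ⊆ (chartAt (EuclideanSpace ℝ (Fin n)) (x : M)).source ∧ ∃ b : ℝ, ∀ y ∈ V,
        ∀ ξ : EuclideanSpace ℝ (Fin n) →L[ℝ] ℝ,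
          A y (coordCovector (x : M) y ξ) (coordCovector (x : M) y ξ) ≤ b * ‖ξ‖ ^ 2 := by
    intro x
    obtain ⟨W, hW, a, b, -, h⟩ := hA.bounds (x : M)
    obtain ⟨V, hV, hVo, hxV⟩ := mem_nhds_iff.1 (Filter.inter_mem hW (Filter.inter_mem
      (hU.mem_nhds (hφU x.2)) (chart_source_mem_nhds (EuclideanSpace ℝ (Fin n)) (x : M))))
    exact ⟨V, hVo, hxV, fun y hy => (hV hy).2.1, fun y hy => (hV hy).2.2, b,
      fun y hy ξ => (h y (hV hy).1 ξ).2⟩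
  choose V hVo hxV hVU hVs b hb using hloc
  obtain ⟨t, ht⟩ := hc.isCompact.elim_finite_subcover V hVo
    (fun x hx => Set.mem_iUnion.2 ⟨⟨x, hx⟩, hxV ⟨x, hx⟩⟩)
  obtain ⟨ρ, hρ⟩ := SmoothPartitionOfUnity.exists_isSubordinate (𝓡 n) (isClosed_tsupport φ)
    (fun i : t => V i) (fun i => hVo i) (by
      intro x hx
      obtain ⟨i, hi, hxi⟩ := Set.mem_iUnion₂.1 (ht hx)
      exact Set.mem_iUnion.2 ⟨⟨i, hi⟩, hxi⟩)
  have hsm : ∀ i, ContMDiff (𝓡 n) 𝓘(ℝ, ℝ) 1 (fun x => ρ i x * φ x) := fun i =>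
    ((ρ i).contMDiff.of_le (by simp)).mul hφ
  have hsums : ∀ s : Finset t, ContMDiff (𝓡 n) 𝓘(ℝ, ℝ) 1 (∑ i ∈ s, fun x => ρ i x * φ x) ∧
      ∃ S, IsCompact S ∧ S ⊆ U ∧ IsSmoothLimit A (∑ i ∈ s, fun x => ρ i x * φ x) S := by
    intro s
    induction s using Finset.cons_induction with
    | empty =>
      refine ⟨by rw [Finset.sum_empty]; exact contMDiff_const, ∅, isCompact_empty, Set.empty_subset _, ?_⟩
      intro ε hε
      have hd (x : M) : differential (n := n) (0 : M → ℝ) x = 0 :=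
        differential_eq_zero_of_notMem_tsupport (by simp [tsupport])
      refine ⟨0, contMDiff_const, by simp [tsupport], fun x => ?_⟩
      simp only [Finset.sum_empty, sub_self, hd]
      simp [hε.le]
    | cons i s hi ih =>
      obtain ⟨hsm', S, hS, hSU, hl⟩ := ih
      have hti : tsupport (fun x => ρ i x * φ x) ⊆ V i :=
        (tsupport_mul_subset_left (f := ρ i) (g := φ)).trans (hρ i)
      obtain ⟨T, hT, hTV, hlT⟩ := isSmoothLimit_of_tsupport_subset_chart (hsm i)
        (hc.mul_left (f := ρ i)) (hVo i) (hVs i) hti (hb i)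
      rw [Finset.sum_cons]
      exact ⟨(hsm i).add hsm', T ∪ S, hT.union hS,
        Set.union_subset (hTV.trans (hVU i)) hSU, hlT.add hA (hsm i) hsm' hl⟩
  obtain ⟨-, S, hS, hSU, hl⟩ := hsums Finset.univ
  have hsum : (∑ i, fun x => ρ i x * φ x) = φ := by
    ext x
    rw [Finset.sum_apply, ← Finset.sum_mul]
    by_cases hx : x ∈ tsupport φ
    · have := ρ.sum_eq_one hx
      rw [finsum_eq_sum_of_fintype] at this
      rw [this, one_mul]
    · rw [image_eq_zero_of_notMem_tsupport hx, mul_zero]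
  rw [hsum] at hl
  refine ⟨S ∪ tsupport φ, hS.union hc, Set.union_subset hSU hφU, Set.subset_union_right, ?_⟩
  intro ε hε
  obtain ⟨w, hw, hwS, h⟩ := hl ε hε
  exact ⟨w, hw, hwS.trans Set.subset_union_left, h⟩

end Approximation

/-! ### The quadratic form on `C¹` functions -/

section Forms

set_option linter.unusedSectionVars false

variable {n : ℕ} {M : Type*} [TopologicalSpace M] [ChartedSpace (EuclideanSpace ℝ (Fin n)) M]
  [MeasurableSpace M] {ν : Measure M} {A : CoeffField n M}

theorem IsElliptic.sub_le (hA : IsElliptic ν A) (x : M) (ξ ζ : TangentSpace (𝓡 n) x →L[ℝ] ℝ) :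
    A x (ξ - ζ) (ξ - ζ) ≤ 2 * A x ξ ξ + 2 * A x ζ ζ := by
  have h := hA.add_le x ξ (-ζ)
  rw [← sub_eq_add_neg] at h
  simpa only [map_neg, LinearMap.neg_apply, neg_neg] using h

theorem IsElliptic.form_comm (hA : IsElliptic ν A) (u w : M → ℝ) :
    form ν A u w = form ν A w u :=
  integral_congr_ae (Eventually.of_forall fun x => hA.symm x _ _)

theorem IsElliptic.form_self_nonneg (hA : IsElliptic ν A) (u : M → ℝ) : 0 ≤ form ν A u u :=
  integral_nonneg fun x => hA.nonneg x _

variable [T2Space M] [SigmaCompactSpace M] [BorelSpace M] [IsManifold (𝓡 n) ∞ M]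
  [IsLocallyFiniteMeasure ν]

theorem IsElliptic.form_sub_right (hA : IsElliptic ν A) {u w z : M → ℝ} {U : Set M}
    (hU : IsOpen U) (hu : ContMDiffOn (𝓡 n) 𝓘(ℝ, ℝ) 1 u U) (hw : ContMDiff (𝓡 n) 𝓘(ℝ, ℝ) 1 w)
    (hz : ContMDiff (𝓡 n) 𝓘(ℝ, ℝ) 1 z) (hwc : HasCompactSupport w) (hzc : HasCompactSupport z)
    (hwU : tsupport w ⊆ U) (hzU : tsupport z ⊆ U) :
    form ν A u (w - z) = form ν A u w - form ν A u z := by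
  unfold form
  rw [← integral_sub (hA.integrable_pairing hU hu hw.contMDiffOn hwc hwU)
    (hA.integrable_pairing hU hu hz.contMDiffOn hzc hzU)]
  refine integral_congr_ae (Eventually.of_forall fun x => ?_)
  simp only
  rw [differential_sub ((hw.mdifferentiable one_ne_zero) x)
    ((hz.mdifferentiable one_ne_zero) x), map_sub]

theorem IsElliptic.form_add_right (hA : IsElliptic ν A) {u w z : M → ℝ}
    (hu : ContMDiff (𝓡 n) 𝓘(ℝ, ℝ) 1 u) (hw : ContMDiff (𝓡 n) 𝓘(ℝ, ℝ) 1 w)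
    (hz : ContMDiff (𝓡 n) 𝓘(ℝ, ℝ) 1 z) (hwc : HasCompactSupport w) (hzc : HasCompactSupport z) :
    form ν A u (w + z) = form ν A u w + form ν A u z := by
  unfold form
  rw [← integral_add (hA.integrable_pairing isOpen_univ hu.contMDiffOn hw.contMDiffOn hwc
    (Set.subset_univ _)) (hA.integrable_pairing isOpen_univ hu.contMDiffOn hz.contMDiffOn hzc
    (Set.subset_univ _))]
  refine integral_congr_ae (Eventually.of_forall fun x => ?_)
  simp only
  rw [differential_add ((hw.mdifferentiable one_ne_zero) x)
    ((hz.mdifferentiable one_ne_zero) x), map_add]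

theorem form_smul_right {u w : M → ℝ} (hw : ContMDiff (𝓡 n) 𝓘(ℝ, ℝ) 1 w) (c : ℝ) :
    form ν A u (c • w) = c * form ν A u w := by
  unfold form
  rw [← integral_const_mul]
  refine integral_congr_ae (Eventually.of_forall fun x => ?_)
  simp only
  rw [differential_const_smul ((hw.mdifferentiable one_ne_zero) x), map_smul, smul_eq_mul]

/-- The sequence `w` of smooth functions with support in `S` converges to `φ` uniformly together
with the differentials. -/
structure SmoothApprox (A : CoeffField n M) (S : Set M) (w : ℕ → M → ℝ) (φ : M → ℝ) : Prop where
  contMDiff : ∀ k, ContMDiff (𝓡 n) 𝓘(ℝ, ℝ) ∞ (w k)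
  tsupport_subset : ∀ k, tsupport (w k) ⊆ S
  limit_contMDiff : ContMDiff (𝓡 n) 𝓘(ℝ, ℝ) 1 φ
  limit_tsupport_subset : tsupport φ ⊆ S
  abs_le : ∀ k x, |w k x - φ x| ≤ 1 / ((k : ℝ) + 1)
  pairing_le : ∀ k x, A x (differential (w k - φ) x) (differential (w k - φ) x)
    ≤ 1 / ((k : ℝ) + 1)

theorem IsElliptic.exists_smoothApprox (hA : IsElliptic ν A) {φ : M → ℝ}
    (hφ : ContMDiff (𝓡 n) 𝓘(ℝ, ℝ) 1 φ) (hc : HasCompactSupport φ) {U : Set M} (hU : IsOpen U)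
    (hφU : tsupport φ ⊆ U) :
    ∃ S, IsCompact S ∧ S ⊆ U ∧ ∃ w, SmoothApprox A S w φ := by
  obtain ⟨S, hS, hSU, hφS, h⟩ := exists_isSmoothLimit hA hφ hc hU hφU
  choose w hw hwS hwφ using fun k : ℕ => h (1 / ((k : ℝ) + 1)) (by positivity)
  exact ⟨S, hS, hSU, w, hw, hwS, hφ, hφS, fun k x => (hwφ k x).1, fun k x => (hwφ k x).2⟩

namespace SmoothApprox

variable {S : Set M} {w : ℕ → M → ℝ} {φ : M → ℝ}

theorem mono (h : SmoothApprox A S w φ) {T : Set M} (hST : S ⊆ T) : SmoothApprox A T w φ :=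
  ⟨h.contMDiff, fun k => (h.tsupport_subset k).trans hST, h.limit_contMDiff,
    h.limit_tsupport_subset.trans hST, h.abs_le, h.pairing_le⟩

/-- By Cauchy–Schwarz the integrands differ on `S` by at most `√B * √(1 / (k + 1))`, and `S` has
finite measure. The function `u` need only be `C¹` near `S`. -/
theorem tendsto_form (hA : IsElliptic ν A) (h : SmoothApprox A S w φ) (hS : IsCompact S)
    {U : Set M} (hU : IsOpen U) (hSU : S ⊆ U) {u : M → ℝ}
    (hu : ContMDiffOn (𝓡 n) 𝓘(ℝ, ℝ) 1 u U) :
    Tendsto (fun k => form ν A u (w k)) atTop (𝓝 (form ν A u φ)) := by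
  obtain ⟨B, hB, hBu⟩ := hA.exists_bound_of_isCompact hU hu hS hSU
  have hlim : Tendsto (fun k : ℕ => √B * √(1 / ((k : ℝ) + 1)) * ν.real S) atTop (𝓝 0) := by
    have := (tendsto_one_div_add_atTop_nhds_zero_nat (𝕜 := ℝ)).sqrt
    simpa using (this.const_mul √B).mul_const (ν.real S)
  rw [tendsto_iff_norm_sub_tendsto_zero]
  refine squeeze_zero (fun k => norm_nonneg _) (fun k => ?_) hlim
  have hwc : HasCompactSupport (w k) :=
    hS.of_isClosed_subset (isClosed_tsupport _) (h.tsupport_subset k)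
  have hφc : HasCompactSupport φ :=
    hS.of_isClosed_subset (isClosed_tsupport _) h.limit_tsupport_subset
  rw [← hA.form_sub_right hU hu ((h.contMDiff k).of_le (by simp)) h.limit_contMDiff hwc hφc
    ((h.tsupport_subset k).trans hSU) (h.limit_tsupport_subset.trans hSU), form,
    ← setIntegral_eq_integral_of_forall_compl_eq_zero (s := S)]
  · refine norm_setIntegral_le_of_norm_le_const hS.measure_lt_top fun x hx => ?_
    refine (hA.abs_le x _ _).trans ?_
    gcongr
    · exact hBu x hx
    · exact h.pairing_le k x
  · intro x hx
    rw [differential_eq_zero_of_notMem_tsupport (u := w k - φ), map_zero]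
    intro hx'
    rcases tsupport_sub _ _ hx' with hx' | hx'
    exacts [hx (h.tsupport_subset k hx'), hx (h.limit_tsupport_subset hx')]

theorem form_sub_le (hA : IsElliptic ν A) (h : SmoothApprox A S w φ) (hS : IsCompact S)
    (k l : ℕ) : form ν A (w k - w l) (w k - w l) ≤
      (2 * (1 / ((k : ℝ) + 1)) + 2 * (1 / ((l : ℝ) + 1))) * ν.real S := by
  rw [form, ← setIntegral_eq_integral_of_forall_compl_eq_zero (s := S)]
  · refine (Real.le_norm_self _).trans (norm_setIntegral_le_of_norm_le_const hS.measure_lt_top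
      fun x hx => ?_)
    rw [Real.norm_of_nonneg (hA.nonneg x _)]
    have hd := fun k => ((h.contMDiff k).mdifferentiable (by simp)) x
    have hφd := (h.limit_contMDiff.mdifferentiable one_ne_zero) x
    have heq : w k - w l = (w k - φ) - (w l - φ) := by ring
    rw [heq, differential_sub ((hd k).sub hφd) ((hd l).sub hφd)]
    exact (hA.sub_le x _ _).trans (by linarith [h.pairing_le k x, h.pairing_le l x])
  · intro x hx
    rw [differential_eq_zero_of_notMem_tsupport (u := w k - w l), map_zero]
    intro hx'
    rcases tsupport_sub _ _ hx' with hx' | hx'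
    exacts [hx (h.tsupport_subset k hx'), hx (h.tsupport_subset l hx')]

end SmoothApprox

theorem IsLocallyEssBounded.exists_bound {U S : Set M} {f : M → ℝ}
    (hf : IsLocallyEssBounded ν U f) (hS : IsCompact S) (hSU : S ⊆ U) :
    ∃ B : ℝ, ∀ᵐ y ∂(ν.restrict S), |f y| ≤ B := by
  refine hS.induction_on (p := fun S => ∃ B : ℝ, ∀ᵐ y ∂(ν.restrict S), |f y| ≤ B)
    ⟨0, by simp⟩ ?_ ?_ ?_
  · rintro s t hst ⟨B, h⟩
    exact ⟨B, ae_mono (Measure.restrict_mono hst le_rfl) h⟩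
  · rintro s t ⟨B, h⟩ ⟨B', h'⟩
    refine ⟨max B B', ae_restrict_union_iff _ _ _ |>.2 ⟨?_, ?_⟩⟩
    · exact h.mono fun y hy => hy.trans (le_max_left _ _)
    · exact h'.mono fun y hy => hy.trans (le_max_right _ _)
  · intro x hx
    obtain ⟨V, hV, B, h⟩ := hf.2 x (hSU hx)
    exact ⟨V, mem_nhdsWithin_of_mem_nhds hV, B, h⟩

theorem IsLocallyEssBounded.integrableOn {U S : Set M} {f : M → ℝ}
    (hf : IsLocallyEssBounded ν U f) (hS : IsCompact S) (hSU : S ⊆ U) : IntegrableOn f S ν := by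
  obtain ⟨B, hB⟩ := hf.exists_bound hS hSU
  have : IsFiniteMeasure (ν.restrict S) := isFiniteMeasure_restrict.2 hS.measure_lt_top.ne
  exact Integrable.of_bound (hf.1.mono_measure (Measure.restrict_mono hSU le_rfl)) B hB

/-- The definition admits smooth test functions only; both sides pass to the limit along a `C¹`
approximation with supports in a fixed compact subset of `U`. This is needed because `h'(v) ζ` is no
smoother than `v`. -/
theorem IsWeakSolutionOn.form_eq (hA : IsElliptic ν A) {U : Set M} (hU : IsOpen U) {u f : M → ℝ}
    (hu : ContMDiffOn (𝓡 n) 𝓘(ℝ, ℝ) 1 u U) (h : IsWeakSolutionOn ν A U u f) {ζ : M → ℝ}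
    (hζ : ContMDiff (𝓡 n) 𝓘(ℝ, ℝ) 1 ζ) (hc : HasCompactSupport ζ) (hζU : tsupport ζ ⊆ U) :
    form ν A u ζ = ∫ x, f x * ζ x ∂ν := by
  obtain ⟨S, hS, hSU, w, hw⟩ := hA.exists_smoothApprox hζ hc hU hζU
  refine tendsto_nhds_unique (hw.tendsto_form hA hS hU hSU hu) ?_
  have hwt : ∀ k, form ν A u (w k) = ∫ x, f x * w k x ∂ν := fun k => h.2 _ ⟨hw.contMDiff k,
    hS.of_isClosed_subset (isClosed_tsupport _) (hw.tsupport_subset k),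
    (hw.tsupport_subset k).trans hSU⟩
  simp only [hwt]
  have hres : ∀ z : M → ℝ, tsupport z ⊆ S → ∫ x, f x * z x ∂ν = ∫ x in S, f x * z x ∂ν := by
    intro z hz
    refine (setIntegral_eq_integral_of_forall_compl_eq_zero fun x hx => ?_).symm
    rw [image_eq_zero_of_notMem_tsupport fun hx' => hx (hz hx'), mul_zero]
  rw [hres ζ hw.limit_tsupport_subset]
  simp only [fun k => hres (w k) (hw.tsupport_subset k)]
  obtain ⟨B, hB⟩ := h.1.exists_bound hS hSU
  have hlim : Tendsto (fun k : ℕ => |B| * (1 / ((k : ℝ) + 1)) * ν.real S) atTop (𝓝 0) := by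
    simpa using ((tendsto_one_div_add_atTop_nhds_zero_nat (𝕜 := ℝ)).const_mul |B|).mul_const
      (ν.real S)
  have hint := h.1.integrableOn hS hSU
  rw [tendsto_iff_norm_sub_tendsto_zero]
  refine squeeze_zero (fun k => norm_nonneg _) (fun k => ?_) hlim
  rw [← integral_sub (hint.mul_continuousOn (hw.contMDiff k).continuous.continuousOn hS)
    (hint.mul_continuousOn hζ.continuous.continuousOn hS)]
  refine norm_setIntegral_le_of_norm_le_const_ae hS.measure_lt_top ?_
  filter_upwards [hB] with x hx
  rw [← mul_sub, norm_mul]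
  exact mul_le_mul (hx.trans (le_abs_self B)) (hw.abs_le k x) (norm_nonneg _) (abs_nonneg B)

theorem eLpNorm_two_le_of_bound {F : Type*} [NormedAddCommGroup F] {g : M → F} {S : Set M}
    {c : ℝ} (hgS : Function.support g ⊆ S) (hg : ∀ x, ‖g x‖ ≤ c) :
    eLpNorm g 2 ν ≤ ν S ^ (1 / 2 : ℝ) * ENNReal.ofReal c := by
  rw [← eLpNorm_restrict_eq_of_support_subset hgS]
  refine (eLpNorm_le_of_ae_bound (Eventually.of_forall hg)).trans (le_of_eq ?_)
  simp

/-- It places compactly supported `C¹` functions in the domain of the closed form, and shows that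
the closed form is there still given by the integral. Real and imaginary parts are approximated
separately, with supports in a common compact set. -/
theorem IsElliptic.exists_formConverges (hA : IsElliptic ν A) {φ : M → ℂ}
    (hφ : ContMDiff (𝓡 n) 𝓘(ℝ, ℂ) 1 φ) (hc : HasCompactSupport φ) :
    ∃ w, FormConverges ν A w φ ∧ ∀ ζ : M → ℝ, IsTestFunction n Set.univ ζ →
      Tendsto (fun k => complexForm ν A (w k) ζ) atTop (𝓝 (complexForm ν A φ ζ)) := by
  obtain ⟨S, hS, -, p, hp⟩ := hA.exists_smoothApprox (φ := fun x => (φ x).re)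
    (Complex.reCLM.contDiff.contMDiff.comp hφ) (hc.comp_left (g := Complex.re) rfl)
    isOpen_univ (Set.subset_univ _)
  obtain ⟨T, hT, -, q, hq⟩ := hA.exists_smoothApprox (φ := fun x => (φ x).im)
    (Complex.imCLM.contDiff.contMDiff.comp hφ) (hc.comp_left (g := Complex.im) rfl)
    isOpen_univ (Set.subset_univ _)
  replace hp := hp.mono (Set.subset_union_left (t := T))
  replace hq := hq.mono (Set.subset_union_right (s := S))
  replace hS := hS.union hT
  set R := S ∪ T
  set w : ℕ → M → ℂ := fun k x => (p k x : ℂ) + Complex.I * (q k x : ℂ) with hw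
  have hre : ∀ k x, (w k x).re = p k x := fun k x => by simp [hw]
  have him : ∀ k x, (w k x).im = q k x := fun k x => by simp [hw]
  have hsupp : ∀ k, tsupport (w k) ⊆ R := by
    intro k
    refine closure_minimal (fun x hx => ?_) hS.isClosed
    by_contra hxR
    refine hx ?_
    simp [hw, image_eq_zero_of_notMem_tsupport fun h => hxR (hp.tsupport_subset k h),
      image_eq_zero_of_notMem_tsupport fun h => hxR (hq.tsupport_subset k h)]
  have hφR : tsupport φ ⊆ R := by
    refine closure_minimal (fun x hx => ?_) hS.isClosed
    by_contra hxR
    refine hx (Complex.ext ?_ ?_)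
    · exact image_eq_zero_of_notMem_tsupport (f := fun x => (φ x).re)
        fun h => hxR (hp.limit_tsupport_subset h)
    · exact image_eq_zero_of_notMem_tsupport (f := fun x => (φ x).im)
        fun h => hxR (hq.limit_tsupport_subset h)
  refine ⟨w, ⟨fun k => ⟨?_, ?_, Set.subset_univ _⟩, ?_, ?_⟩, ?_⟩
  · have h1 : ContMDiff (𝓡 n) 𝓘(ℝ, ℂ) ∞ (fun x => (p k x : ℂ)) :=
      Complex.ofRealCLM.contDiff.contMDiff.comp (hp.contMDiff k)
    have h2 : ContMDiff (𝓡 n) 𝓘(ℝ, ℂ) ∞ (fun x => Complex.I * (q k x : ℂ)) :=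
      (((ContinuousLinearMap.mul ℝ ℂ Complex.I).comp Complex.ofRealCLM).contDiff.contMDiff).comp
        (hq.contMDiff k)
    exact h1.add h2
  · exact hS.of_isClosed_subset (isClosed_tsupport _) (hsupp k)
  · have hlim : Tendsto (fun k : ℕ => ν R ^ (1 / 2 : ℝ) *
        ENNReal.ofReal (2 * (1 / ((k : ℝ) + 1)))) atTop (𝓝 0) := by
      have h1 := ENNReal.tendsto_ofReal
        ((tendsto_one_div_add_atTop_nhds_zero_nat (𝕜 := ℝ)).const_mul 2)
      have h2 := ENNReal.Tendsto.const_mul (a := ν R ^ (1 / 2 : ℝ)) h1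
        (Or.inr (ENNReal.rpow_ne_top_of_nonneg (by norm_num) hS.measure_lt_top.ne))
      simpa using h2
    refine tendsto_of_tendsto_of_tendsto_of_le_of_le tendsto_const_nhds hlim
      (fun k => zero_le) fun k => ?_
    refine eLpNorm_two_le_of_bound ?_ fun x => ?_
    · intro x hx
      by_contra hxR
      refine hx ?_
      rw [Pi.sub_apply, image_eq_zero_of_notMem_tsupport fun h => hxR (hsupp k h),
        image_eq_zero_of_notMem_tsupport fun h => hxR (hφR h), sub_zero]
    · refine (Complex.norm_le_abs_re_add_abs_im _).trans ?_
      rw [Pi.sub_apply, Complex.sub_re, Complex.sub_im, hre, him, two_mul]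
      exact add_le_add (hp.abs_le k x) (hq.abs_le k x)
  · intro ε hε
    have hbound : ∀ k l, energy ν A (w k - w l) ≤
        2 * ((2 * (1 / ((k : ℝ) + 1)) + 2 * (1 / ((l : ℝ) + 1))) * ν.real R) := by
      intro k l
      have h1 : (fun x => ((w k - w l) x).re) = p k - p l := by
        ext x; rw [Pi.sub_apply, Complex.sub_re, hre, hre]; rfl
      have h2 : (fun x => ((w k - w l) x).im) = q k - q l := by
        ext x; rw [Pi.sub_apply, Complex.sub_im, him, him]; rfl
      rw [energy, h1, h2, two_mul]
      exact add_le_add (hp.form_sub_le hA hS k l) (hq.form_sub_le hA hS k l)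
    -- For `k, l ≥ N` the bound `hbound` is at most `2 * (2 + 2) / (N + 1)` times the measure of
    -- `R`, whence the 8.
    have hlim : Tendsto (fun k : ℕ => 8 * (1 / ((k : ℝ) + 1)) * ν.real R) atTop (𝓝 0) := by
      simpa using ((tendsto_one_div_add_atTop_nhds_zero_nat (𝕜 := ℝ)).const_mul 8).mul_const
        (ν.real R)
    obtain ⟨N, hN⟩ := (hlim.eventually (gt_mem_nhds hε)).exists
    refine ⟨N, fun k hk l hl => (hbound k l).trans_lt (lt_of_le_of_lt ?_ hN)⟩
    have h1 : 1 / ((k : ℝ) + 1) ≤ 1 / ((N : ℝ) + 1) := by gcongr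
    have h2 : 1 / ((l : ℝ) + 1) ≤ 1 / ((N : ℝ) + 1) := by gcongr
    have h3 : 0 ≤ ν.real R := measureReal_nonneg
    nlinarith
  · intro ζ hζ
    have hζ1 : ContMDiffOn (𝓡 n) 𝓘(ℝ, ℝ) 1 ζ Set.univ := (hζ.1.of_le (by simp)).contMDiffOn
    have h1 := hp.tendsto_form hA hS isOpen_univ (Set.subset_univ _) hζ1
    have h2 := hq.tendsto_form hA hS isOpen_univ (Set.subset_univ _) hζ1
    have h3 : ∀ k, complexForm ν A (w k) ζ =
        (form ν A ζ (p k) : ℂ) + Complex.I * (form ν A ζ (q k) : ℂ) := fun k => by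
      simp only [complexForm, hre, him]
      rw [hA.form_comm, hA.form_comm (fun x => q k x)]
    simp only [h3]
    rw [complexForm, hA.form_comm, hA.form_comm (fun x => (φ x).im)]
    exact ((Complex.continuous_ofReal.tendsto _).comp h1).add
      (((Complex.continuous_ofReal.tendsto _).comp h2).const_mul _)

end Forms

end DivForm

/-! ### Consequences of subexponential volume growth -/

section Growth

theorem DivForm.eventually_le_exp_of_growthRate_eq_zero {χ : Measure ℝ}
    (h : DivForm.growthRate χ = 0) {δ : ℝ} (hδ : 0 < δ) :
    ∀ᶠ r : ℝ in atTop, χ (Set.Icc 0 r) ≤ ENNReal.ofReal (Real.exp (δ * r)) := by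
  have hlt : DivForm.growthRate χ < ((δ : ℝ) : EReal) := by
    rw [h]; exact_mod_cast hδ
  filter_upwards [eventually_lt_of_limsup_lt hlt, eventually_gt_atTop 0] with r hr hr0
  have hr0' : 0 < r⁻¹ := inv_pos.2 hr0
  rw [← ENNReal.log_le_log_iff, ENNReal.log_ofReal, if_neg (not_le.2 (Real.exp_pos _)),
    Real.log_exp]
  -- The logarithm is `-∞` when the interval is null, and `+∞` is excluded by the strict bound `hr`.
  induction hx : ENNReal.log (χ (Set.Icc 0 r)) using EReal.rec with
  | bot => exact bot_le
  | top =>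
    rw [hx, EReal.coe_mul_top_of_pos hr0'] at hr
    exact absurd hr not_top_lt
  | coe x =>
    rw [hx, ← EReal.coe_mul, EReal.coe_lt_coe_iff] at hr
    rw [EReal.coe_le_coe_iff]
    have : r⁻¹ * x * r < δ * r := mul_lt_mul_of_pos_right hr hr0
    have h2 : r⁻¹ * x * r = x := by field_simp
    linarith

/-- Let `W j` be the mass of `[R, R + jl]`. If `W (j + 1) > 2 W j` for all large `j`, then `W` grows
at least like `2 ^ j`, against subexponential growth; so some late step at most doubles the mass. As
`W j` tends to infinity, the first interval `[R, R + l]` eventually carries less than half of it. -/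
theorem exists_measure_Icc_le_four_mul {χ : Measure ℝ} (hfin : ∀ r, χ (Set.Icc 0 r) < ⊤)
    (hinf : χ (Set.Ici 0) = ⊤)
    (hexp : ∀ δ : ℝ, 0 < δ → ∀ᶠ r : ℝ in atTop, χ (Set.Icc 0 r) ≤ ENNReal.ofReal (Real.exp (δ * r)))
    {R l : ℝ} (hR : 0 ≤ R) (hl : 0 < l) :
    ∃ S, R + 2 * l ≤ S ∧ χ (Set.Icc R S) ≤ 4 * χ (Set.Icc (R + l) (S - l)) ∧
      0 < χ (Set.Icc (R + l) (S - l)) := by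
  set W : ℕ → ENNReal := fun j => χ (Set.Icc R (R + j * l)) with hW
  have hmono : Monotone fun j : ℕ => Set.Icc R (R + j * l) := by
    intro i j hij
    refine Set.Icc_subset_Icc_right ?_
    have : (i : ℝ) ≤ j := by exact_mod_cast hij
    nlinarith
  have hWfin : ∀ j, W j < ⊤ := fun j =>
    (measure_mono (Set.Icc_subset_Icc_left hR)).trans_lt (hfin _)
  have hunion : ⋃ j : ℕ, Set.Icc R (R + j * l) = Set.Ici R := by
    ext r
    simp only [Set.mem_iUnion, Set.mem_Icc, Set.mem_Ici]
    refine ⟨fun ⟨j, hj⟩ => hj.1, fun hr => ?_⟩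
    obtain ⟨j, hj⟩ := exists_nat_ge ((r - R) / l)
    refine ⟨j, hr, ?_⟩
    rw [div_le_iff₀ hl] at hj
    linarith
  have hIci : χ (Set.Ici R) = ⊤ := by
    by_contra hne
    have hle : χ (Set.Ici 0) ≤ χ (Set.Icc 0 R) + χ (Set.Ici R) := by
      refine (measure_mono ?_).trans (measure_union_le _ _)
      rw [Set.Icc_union_Ici_eq_Ici hR]
    rw [hinf] at hle
    exact absurd hle (not_le.2 (ENNReal.add_lt_top.2 ⟨hfin R, lt_top_iff_ne_top.2 hne⟩))
  have hWlim : Tendsto W atTop (𝓝 ⊤) := by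
    have := tendsto_measure_iUnion_atTop (μ := χ) hmono
    rwa [hunion, hIci] at this
  -- Past `j₀` the mass of `[R + l, R + jl]` exceeds `W 1`. The summand 2 makes that mass positive
  -- even if `W 1 = 0`, and lets the doubling below start from `1 ≤ W j₀`.
  have hWlarge : ∃ j₀ : ℕ, ∀ j ≥ j₀, 2 * W 1 + 2 ≤ W j := by
    have hlt : 2 * W 1 + 2 < ⊤ := ENNReal.add_lt_top.2
      ⟨ENNReal.mul_lt_top (by simp) (hWfin 1), by simp⟩
    obtain ⟨j₀, hj₀⟩ := eventually_atTop.1 (hWlim.eventually (lt_mem_nhds hlt))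
    exact ⟨j₀, fun j hj => (hj₀ j hj).le⟩
  obtain ⟨j₀, hj₀⟩ := hWlarge
  have hex : ∃ j ≥ j₀, W (j + 1) ≤ 2 * W j := by
    by_contra! hcon
    have hgrow : ∀ i : ℕ, (2 : ENNReal) ^ i ≤ W (j₀ + i) := by
      intro i
      induction i with
      | zero =>
        refine le_trans ?_ (hj₀ j₀ le_rfl)
        rw [pow_zero]
        exact le_add_left (by norm_num)
      | succ i ih =>
        rw [pow_succ, mul_comm]
        exact (mul_le_mul_right ih 2).trans (hcon (j₀ + i) (Nat.le_add_right _ _)).le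
    have hlog : 0 < Real.log 2 := Real.log_pos one_lt_two
    -- Doubling at every step of length `l` is growth at rate `log 2 / l`; half of this rate already
    -- gives a contradiction.
    set δ := Real.log 2 / (2 * l) with hδ
    have hδ0 : 0 < δ := by positivity
    have hr : Tendsto (fun i : ℕ => R + ((j₀ + i : ℕ) : ℝ) * l) atTop atTop := by
      refine tendsto_atTop_add_const_left _ _ (Tendsto.atTop_mul_const hl ?_)
      exact tendsto_natCast_atTop_atTop.comp (tendsto_add_atTop_nat j₀ |>.congr fun i => by ring)
    have hlin : ∀ᶠ i : ℕ in atTop, δ * (R + j₀ * l) < i * (Real.log 2 / 2) :=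
      (tendsto_natCast_atTop_atTop.atTop_mul_const (by positivity)).eventually_gt_atTop _
    obtain ⟨i, hi, hi'⟩ := ((hr.eventually (hexp δ hδ0)).and hlin).exists
    have h1 := (hgrow i).trans ((measure_mono (Set.Icc_subset_Icc_left hR)).trans hi)
    have h2 : (2 : ENNReal) ^ i = ENNReal.ofReal (2 ^ i) := by
      rw [ENNReal.ofReal_pow (by norm_num)]; simp
    rw [h2, ENNReal.ofReal_le_ofReal_iff (Real.exp_pos _).le,
      ← Real.exp_log (show (0 : ℝ) < 2 ^ i by positivity), Real.exp_le_exp, Real.log_pow] at h1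
    have h3 : δ * (R + ((j₀ + i : ℕ) : ℝ) * l) = δ * (R + j₀ * l) + i * (Real.log 2 / 2) := by
      rw [hδ]; push_cast; field_simp; ring
    rw [h3] at h1
    nlinarith
  obtain ⟨j, hj, hj2⟩ := hex
  have hSl : R + ((j + 1 : ℕ) : ℝ) * l - l = R + j * l := by push_cast; ring
  set b := χ (Set.Icc (R + l) (R + j * l)) with hb
  have hWab : W j ≤ W 1 + b := by
    refine (measure_mono ?_).trans (measure_union_le _ _)
    intro r hr
    simp only [Set.mem_union, Set.mem_Icc, Nat.cast_one, one_mul] at hr ⊢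
    rcases le_total r (R + l) with h | h
    · exact Or.inl ⟨hr.1, h⟩
    · exact Or.inr ⟨h, hr.2⟩
  have hab : W 1 + 2 ≤ b := by
    have := (hj₀ j hj).trans hWab
    rw [two_mul, add_assoc] at this
    exact (ENNReal.add_le_add_iff_left (hWfin 1).ne).1 this
  have hb0 : 0 < b := lt_of_lt_of_le (by simp) hab
  have hj1 : 1 ≤ j := by
    by_contra hj1
    have : j = 0 := by omega
    rw [hb, this, Set.Icc_eq_empty (by simp [hl])] at hb0
    simp at hb0
  -- With this endpoint the mass of `[R, S]` is `W (j + 1) ≤ 2 W j ≤ 2 (W 1 + b) ≤ 4 b`, where `b`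
  -- is the mass of `[R + l, S - l]`.
  refine ⟨R + ((j + 1 : ℕ) : ℝ) * l, ?_, ?_, ?_⟩
  · have : (1 : ℝ) ≤ j := by exact_mod_cast hj1
    push_cast
    nlinarith
  · rw [hSl]
    refine hj2.trans ((mul_le_mul_right hWab 2).trans ?_)
    calc 2 * (W 1 + b) ≤ 2 * (b + b) := by gcongr; exact (le_add_right le_rfl).trans hab
      _ = 4 * b := by ring
  · rwa [hSl]

end Growth

/-! ### Slowly varying cutoffs and their modulation -/

section Cutoff

/-- The transition is constant off `[0, 1]`, so its first two derivatives are continuous with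
compact support. -/
theorem Real.smoothTransition.exists_deriv_bound :
    ∃ c : ℝ, 0 < c ∧ ∀ x, |deriv Real.smoothTransition x| ≤ c ∧
      |deriv (deriv Real.smoothTransition) x| ≤ c := by
  have h1 : ContDiff ℝ 1 (deriv Real.smoothTransition) :=
    ((contDiff_succ_iff_deriv (n := 1)).1 (Real.smoothTransition.contDiff (n := 2))).2.2
  have hz : ∀ x ∉ Set.Icc (0 : ℝ) 1, deriv Real.smoothTransition x = 0 := by
    intro x hx
    rw [Set.mem_Icc, not_and_or, not_le, not_le] at hx
    rcases hx with hx | hx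
    · have : Real.smoothTransition =ᶠ[𝓝 x] fun _ => (0 : ℝ) := by
        filter_upwards [gt_mem_nhds hx] with y hy
        exact Real.smoothTransition.zero_of_nonpos hy.le
      rw [this.deriv_eq, deriv_const]
    · have : Real.smoothTransition =ᶠ[𝓝 x] fun _ => (1 : ℝ) := by
        filter_upwards [lt_mem_nhds hx] with y hy
        exact Real.smoothTransition.one_of_one_le hy.le
      rw [this.deriv_eq, deriv_const]
  have hc : HasCompactSupport (deriv Real.smoothTransition) :=
    HasCompactSupport.intro isCompact_Icc hz
  obtain ⟨a, ha⟩ := h1.continuous.bounded_above_of_compact_support hc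
  obtain ⟨b, hb⟩ := (h1.continuous_deriv le_rfl).bounded_above_of_compact_support hc.deriv
  exact ⟨max 1 (max a b), by positivity, fun x => ⟨(ha x).trans (by simp), (hb x).trans (by simp)⟩⟩

theorem hasDerivAt_comp_sub_div {f : ℝ → ℝ} (hf : Differentiable ℝ f) (p l r : ℝ) :
    HasDerivAt (fun r => f ((r - p) / l)) (deriv f ((r - p) / l) * l⁻¹) r := by
  have h1 : HasDerivAt (fun r : ℝ => (r - p) / l) l⁻¹ r := by
    simpa using ((hasDerivAt_id r).sub_const p).div_const l
  exact (hf _).hasDerivAt.comp r h1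

/-- The cutoff is the difference of two smooth transitions of width `l`, one rising from `R` and one
rising from `S - l`. The second derivative is of order `1 / l²`, which `1 ≤ l` reduces to `1 / l`,
so that one constant serves both derivatives. -/
theorem exists_cutoff : ∃ c : ℝ, 0 < c ∧ ∀ R S l : ℝ, 1 ≤ l → R + 2 * l ≤ S → ∃ ψ : ℝ → ℝ,
    ContDiff ℝ ∞ ψ ∧ (∀ r, |ψ r| ≤ 1) ∧ (∀ r ∉ Set.Icc R S, ψ r = 0) ∧
    (∀ r ∈ Set.Icc (R + l) (S - l), ψ r = 1) ∧
    ∀ r, |deriv ψ r| ≤ c / l ∧ |deriv (deriv ψ) r| ≤ c / l := by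
  obtain ⟨c, hc, hbd⟩ := Real.smoothTransition.exists_deriv_bound
  refine ⟨2 * c, by positivity, fun R S l hl hRS => ?_⟩
  have hl0 : 0 < l := by linarith
  have hsm : ContDiff ℝ ∞ Real.smoothTransition := Real.smoothTransition.contDiff
  have hdiff : Differentiable ℝ Real.smoothTransition := hsm.differentiable (by simp)
  have hdiff' : Differentiable ℝ (deriv Real.smoothTransition) :=
    ((contDiff_infty_iff_deriv).1 hsm).2.differentiable (by simp)
  set ψ : ℝ → ℝ := fun r => Real.smoothTransition ((r - R) / l) -
    Real.smoothTransition ((r - (S - l)) / l) with hψ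
  have hd : ∀ r, HasDerivAt ψ (deriv Real.smoothTransition ((r - R) / l) * l⁻¹ -
      deriv Real.smoothTransition ((r - (S - l)) / l) * l⁻¹) r := fun r =>
    (hasDerivAt_comp_sub_div hdiff R l r).sub (hasDerivAt_comp_sub_div hdiff (S - l) l r)
  have hdeq : deriv ψ = fun r => deriv Real.smoothTransition ((r - R) / l) * l⁻¹ -
      deriv Real.smoothTransition ((r - (S - l)) / l) * l⁻¹ := funext fun r => (hd r).deriv
  have hd2 : ∀ r, HasDerivAt (deriv ψ)
      (deriv (deriv Real.smoothTransition) ((r - R) / l) * l⁻¹ * l⁻¹ -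
      deriv (deriv Real.smoothTransition) ((r - (S - l)) / l) * l⁻¹ * l⁻¹) r := fun r => by
    rw [hdeq]
    exact ((hasDerivAt_comp_sub_div hdiff' R l r).mul_const _).sub
      ((hasDerivAt_comp_sub_div hdiff' (S - l) l r).mul_const _)
  have hli : l⁻¹ ≤ 1 := inv_le_one_of_one_le₀ hl
  have hli0 : 0 < l⁻¹ := inv_pos.2 hl0
  refine ⟨ψ, ?_, fun r => ?_, fun r hr => ?_, fun r hr => ?_, fun r => ⟨?_, ?_⟩⟩
  · exact (hsm.comp ((contDiff_id.sub contDiff_const).div_const l)).sub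
      (hsm.comp ((contDiff_id.sub contDiff_const).div_const l))
  · rw [abs_le]
    have h1 := Real.smoothTransition.nonneg ((r - R) / l)
    have h2 := Real.smoothTransition.nonneg ((r - (S - l)) / l)
    have h3 := Real.smoothTransition.le_one ((r - R) / l)
    have h4 := Real.smoothTransition.le_one ((r - (S - l)) / l)
    constructor <;> simp only [hψ] <;> linarith
  · rw [Set.mem_Icc, not_and_or, not_le, not_le] at hr
    simp only [hψ]
    rcases hr with hr | hr
    · rw [Real.smoothTransition.zero_of_nonpos, Real.smoothTransition.zero_of_nonpos, sub_zero]
      · exact div_nonpos_of_nonpos_of_nonneg (by linarith) hl0.le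
      · exact div_nonpos_of_nonpos_of_nonneg (by linarith) hl0.le
    · rw [Real.smoothTransition.one_of_one_le, Real.smoothTransition.one_of_one_le, sub_self]
      · rw [le_div_iff₀ hl0]; linarith
      · rw [le_div_iff₀ hl0]; linarith
  · simp only [hψ]
    rw [Real.smoothTransition.one_of_one_le, Real.smoothTransition.zero_of_nonpos, sub_zero]
    · exact div_nonpos_of_nonpos_of_nonneg (by linarith [hr.2]) hl0.le
    · rw [le_div_iff₀ hl0]; linarith [hr.1]
  · rw [(hd r).deriv, ← sub_mul, abs_mul, abs_of_pos hli0, div_eq_mul_inv (2 * c) l]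
    refine mul_le_mul_of_nonneg_right ((abs_sub _ _).trans ?_) hli0.le
    linarith [(hbd ((r - R) / l)).1, (hbd ((r - (S - l)) / l)).1]
  · rw [(hd2 r).deriv, ← sub_mul, ← sub_mul, abs_mul, abs_mul, abs_of_pos hli0, div_eq_mul_inv (2 * c) l]
    refine mul_le_mul_of_nonneg_right ?_ hli0.le
    refine (mul_le_of_le_one_right (abs_nonneg _) hli).trans ((abs_sub _ _).trans ?_)
    linarith [(hbd ((r - R) / l)).2, (hbd ((r - (S - l)) / l)).2]

/-- For `h = ψ exp(iλr)` the terms without a derivative of `ψ` cancel, leaving `h'' + λ² h = (ψ'' +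
2iλψ') exp(iλr)`, small when `ψ` varies slowly. Using the set `‖h r‖ = 1` in place of the plateau
keeps the width `l` out of the statement. -/
theorem exists_modulated_cutoff {χ : Measure ℝ} (hfin : ∀ r, χ (Set.Icc 0 r) < ⊤)
    (hinf : χ (Set.Ici 0) = ⊤)
    (hexp : ∀ δ : ℝ, 0 < δ → ∀ᶠ r : ℝ in atTop, χ (Set.Icc 0 r) ≤ ENNReal.ofReal (Real.exp (δ * r)))
    {R ε lam : ℝ} (hR : 0 ≤ R) (hε : 0 < ε) (hlam : 0 ≤ lam) :
    ∃ S, ∃ h : ℝ → ℂ, ContDiff ℝ ∞ h ∧ (∀ r ∉ Set.Icc R S, h r = 0) ∧ (∀ r, ‖h r‖ ≤ 1) ∧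
      (∀ r, ‖deriv h r‖ ≤ ε + lam) ∧
      (∀ r, ‖deriv (deriv h) r + (lam : ℂ) ^ 2 * h r‖ ≤ (1 + 2 * lam) * ε) ∧
      χ (Set.Icc R S) ≤ 4 * χ {r | ‖h r‖ = 1} ∧ 0 < χ {r | ‖h r‖ = 1} := by
  obtain ⟨c, hc, hcut⟩ := exists_cutoff
  -- This width makes both derivatives of the cutoff at most `c / l ≤ ε`.
  set l := max 1 (c / ε) with hl
  have hl1 : 1 ≤ l := le_max_left _ _
  have hl0 : 0 < l := by linarith
  have hcl : c / l ≤ ε := by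
    rw [div_le_iff₀ hl0, mul_comm, ← div_le_iff₀ hε]
    exact le_max_right _ _
  obtain ⟨S, hS, hχ4, hχ0⟩ := exists_measure_Icc_le_four_mul hfin hinf hexp hR hl0
  obtain ⟨ψ, hψ, hψ1, hψz, hψo, hψd⟩ := hcut R S l hl1 hS
  set e : ℝ → ℂ := fun r => Complex.exp ((lam * r : ℝ) * Complex.I) with he
  have hen : ∀ r, ‖e r‖ = 1 := fun r => Complex.norm_exp_ofReal_mul_I _
  have hed : ∀ r, HasDerivAt e (lam * Complex.I * e r) r := by
    intro r
    have h1 : HasDerivAt (fun r : ℝ => ((lam * r : ℝ) : ℂ) * Complex.I) (lam * Complex.I) r := by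
      have := (((hasDerivAt_id r).const_mul lam).ofReal_comp).mul_const Complex.I
      simpa using this
    have := h1.cexp
    rwa [mul_comm] at this
  have hesm : ContDiff ℝ ∞ e :=
    ((Complex.ofRealCLM.contDiff.comp (contDiff_const.mul contDiff_id)).mul contDiff_const).cexp
  have hψsm' : ContDiff ℝ ∞ (deriv ψ) := ((contDiff_infty_iff_deriv).1 hψ).2
  set ψ₁ : ℝ → ℝ := deriv ψ
  set ψ₂ : ℝ → ℝ := deriv ψ₁
  have hψd1 : ∀ r, HasDerivAt (fun r => (ψ r : ℂ)) (ψ₁ r : ℂ) r := fun r =>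
    ((hψ.differentiable (by simp)) r).hasDerivAt.ofReal_comp
  have hψd2 : ∀ r, HasDerivAt (fun r => (ψ₁ r : ℂ)) (ψ₂ r : ℂ) r := fun r =>
    ((hψsm'.differentiable (by simp)) r).hasDerivAt.ofReal_comp
  set h : ℝ → ℂ := fun r => ψ r * e r with hh
  have hd1 : ∀ r, HasDerivAt h ((ψ₁ r + lam * Complex.I * ψ r) * e r) r := fun r => by
    convert! (hψd1 r).mul (hed r) using 1
    ring
  have hdeq : deriv h = fun r => (ψ₁ r + lam * Complex.I * ψ r) * e r :=
    funext fun r => (hd1 r).deriv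
  have hd2 : ∀ r, HasDerivAt (deriv h) ((ψ₂ r + 2 * lam * Complex.I * ψ₁ r
      - lam ^ 2 * ψ r) * e r) r := fun r => by
    rw [hdeq]
    convert! ((hψd2 r).add ((hψd1 r).const_mul (lam * Complex.I))).mul (hed r) using 1
    simp only [Pi.add_apply]
    linear_combination (-(lam : ℂ) ^ 2 * ψ r * e r) * Complex.I_sq
  have hsub : Set.Icc (R + l) (S - l) ⊆ {r | ‖h r‖ = 1} := by
    intro r hr
    simp [hh, hψo r hr, hen]
  have hnr : ∀ x : ℝ, ‖(x : ℂ)‖ = |x| := fun x => Complex.norm_real x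
  refine ⟨S, h, ?_, fun r hr => ?_, fun r => ?_, fun r => ?_, fun r => ?_,
    hχ4.trans (mul_le_mul_right (measure_mono hsub) 4), hχ0.trans_le (measure_mono hsub)⟩
  · exact (Complex.ofRealCLM.contDiff.comp hψ).mul hesm
  · simp [hh, hψz r hr]
  · rw [norm_mul, hen, mul_one, hnr]
    exact hψ1 r
  · rw [(hd1 r).deriv, norm_mul, hen, mul_one]
    refine (norm_add_le _ _).trans (add_le_add ?_ ?_)
    · rw [hnr]; exact (hψd r).1.trans hcl
    · rw [norm_mul, norm_mul, hnr, hnr, Complex.norm_I, mul_one, abs_of_nonneg hlam]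
      exact mul_le_of_le_one_right hlam (hψ1 r)
  · have : deriv (deriv h) r + (lam : ℂ) ^ 2 * h r =
        (ψ₂ r + 2 * lam * Complex.I * ψ₁ r) * e r := by
      rw [(hd2 r).deriv, hh]; ring
    rw [this, norm_mul, hen, mul_one, add_mul, one_mul]
    refine (norm_add_le _ _).trans (add_le_add ?_ ?_)
    · rw [hnr]; exact (hψd r).2.trans hcl
    · rw [norm_mul, norm_mul, norm_mul, hnr, hnr, Complex.norm_I, mul_one, abs_of_nonneg hlam]
      have : ‖(2 : ℂ)‖ = 2 := by simp
      rw [this]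
      exact mul_le_mul_of_nonneg_left ((hψd r).1.trans hcl) (by positivity)

end Cutoff

/-! ### Hölder continuity of the derivative of a composition -/

section Holder

theorem holderOnWith_of_dist_le {X Y : Type*} [PseudoMetricSpace X] [PseudoMetricSpace Y]
    {C r : ℝ≥0} {f : X → Y} {s : Set X}
    (h : ∀ x ∈ s, ∀ y ∈ s, dist (f x) (f y) ≤ C * dist x y ^ (r : ℝ)) : HolderOnWith C r f s := by
  intro x hx y hy
  have := h x hx y hy
  rw [dist_nndist, dist_nndist] at this
  rw [edist_nndist, edist_nndist, ← ENNReal.coe_rpow_of_nonneg (nndist x y) (NNReal.coe_nonneg r),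
    ← ENNReal.coe_mul, ENNReal.coe_le_coe]
  exact_mod_cast this

/-- In the chain rule `h'(u) ∘ u'`, the factor `u'` is bounded and Hölder near `z₀`, and `h'(u)` is
bounded and Lipschitz there. At distances at most one a Lipschitz bound is an `α`-Hölder bound, as
`α ≤ 1`. -/
theorem exists_holderOnWith_fderiv_comp {E F : Type*} [NormedAddCommGroup E] [NormedSpace ℝ E]
    [NormedAddCommGroup F] [NormedSpace ℝ F] {α : ℝ≥0} (hα1 : α ≤ 1) {u : E → ℝ}
    {h : ℝ → F} (hh : ContDiff ℝ 2 h) (hc : HasCompactSupport h) {z₀ : E}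
    (hu : ∀ᶠ z in 𝓝 z₀, DifferentiableAt ℝ u z)
    (hW : ∃ W ∈ 𝓝 z₀, ∃ C : ℝ≥0, HolderOnWith C α (fderiv ℝ u) W) :
    ∃ W ∈ 𝓝 z₀, ∃ C : ℝ≥0, HolderOnWith C α (fderiv ℝ (h ∘ u)) W := by
  obtain ⟨W, hW, C, hC⟩ := hW
  have h1 : ContDiff ℝ 1 (fderiv ℝ h) := hh.fderiv_right (by norm_num)
  obtain ⟨P, hP⟩ := h1.continuous.bounded_above_of_compact_support (hc.fderiv (𝕜 := ℝ))
  obtain ⟨Q, hQ⟩ := (h1.continuous_fderiv one_ne_zero).bounded_above_of_compact_support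
    ((hc.fderiv (𝕜 := ℝ)).fderiv (𝕜 := ℝ))
  have hP0 : 0 ≤ P := (norm_nonneg _).trans (hP 0)
  have hQ0 : 0 ≤ Q := (norm_nonneg _).trans (hQ 0)
  obtain ⟨δ, hδ, hball⟩ := Metric.mem_nhds_iff.1 (Filter.inter_mem hW hu)
  -- Radius at most `1 / 2` keeps distances in the ball below one; convexity of the ball is used for
  -- the mean value inequality.
  set B := Metric.ball z₀ (min δ (1 / 2)) with hB
  have hBδ : B ⊆ Metric.ball z₀ δ := Metric.ball_subset_ball (min_le_left _ _)
  have hdist : ∀ x ∈ B, ∀ y ∈ B, dist x y ≤ 1 := by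
    intro x hx y hy
    have hx' := (Metric.mem_ball.1 hx).le.trans (min_le_right _ _)
    have hy' := (Metric.mem_ball.1 hy).le.trans (min_le_right _ _)
    have := dist_triangle_right x y z₀
    linarith
  have hz₀ : z₀ ∈ B := Metric.mem_ball_self (by positivity)
  set N := ‖fderiv ℝ u z₀‖ + C with hN
  have hN0 : 0 ≤ N := by positivity
  have hle1 : ∀ x ∈ B, ∀ y ∈ B, dist x y ^ (α : ℝ) ≤ 1 := fun x hx y hy =>
    Real.rpow_le_one dist_nonneg (hdist x hx y hy) α.2
  have hNb : ∀ z ∈ B, ‖fderiv ℝ u z‖ ≤ N := by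
    intro z hz
    have h2 := hC.dist_le (hball (hBδ hz)).1 (hball (hBδ hz₀)).1
    rw [dist_eq_norm] at h2
    have h3 := norm_le_norm_add_norm_sub' (fderiv ℝ u z) (fderiv ℝ u z₀)
    have h4 : (C : ℝ) * dist z z₀ ^ (α : ℝ) ≤ C :=
      mul_le_of_le_one_right C.2 (hle1 z hz z₀ hz₀)
    linarith
  have hlip : ∀ x ∈ B, ∀ y ∈ B, ‖u x - u y‖ ≤ N * ‖x - y‖ := fun x hx y hy =>
    (convex_ball z₀ _).norm_image_sub_le_of_norm_fderiv_le (𝕜 := ℝ)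
      (fun z hz => (hball (hBδ hz)).2) hNb hy hx
  have hhlip : ∀ s t : ℝ, ‖fderiv ℝ h s - fderiv ℝ h t‖ ≤ Q * ‖s - t‖ := fun s t =>
    convex_univ.norm_image_sub_le_of_norm_fderiv_le (𝕜 := ℝ)
      (fun z _ => (h1.differentiable one_ne_zero) z) (fun z _ => hQ z)
      (Set.mem_univ t) (Set.mem_univ s)
  have hfd : ∀ z ∈ B, fderiv ℝ (h ∘ u) z = (fderiv ℝ h (u z)).comp (fderiv ℝ u z) := fun z hz =>
    fderiv_comp z ((hh.differentiable (by norm_num)) _) (hball (hBδ hz)).2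
  refine ⟨B, Metric.ball_mem_nhds _ (by positivity), (P * C + Q * N * N).toNNReal,
    holderOnWith_of_dist_le fun x hx y hy => ?_⟩
  rw [Real.coe_toNNReal _ (by positivity), dist_eq_norm, hfd x hx, hfd y hy]
  have hsplit : (fderiv ℝ h (u x)).comp (fderiv ℝ u x) - (fderiv ℝ h (u y)).comp (fderiv ℝ u y) =
      (fderiv ℝ h (u x)).comp (fderiv ℝ u x - fderiv ℝ u y) +
      (fderiv ℝ h (u x) - fderiv ℝ h (u y)).comp (fderiv ℝ u y) := by
    rw [ContinuousLinearMap.comp_sub, ContinuousLinearMap.sub_comp]; abel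
  have hd1 : dist x y ≤ dist x y ^ (α : ℝ) := by
    rcases eq_or_ne (dist x y) 0 with h0 | h0
    · rw [h0]; positivity
    · conv_lhs => rw [← Real.rpow_one (dist x y)]
      exact Real.rpow_le_rpow_of_exponent_ge (lt_of_le_of_ne dist_nonneg h0.symm)
        (hdist x hx y hy) (by exact_mod_cast hα1)
  rw [hsplit, add_mul]
  refine (norm_add_le _ _).trans (add_le_add ?_ ?_)
  · refine (ContinuousLinearMap.opNorm_comp_le _ _).trans ?_
    rw [mul_assoc]
    refine mul_le_mul (hP _) ?_ (norm_nonneg _) hP0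
    rw [← dist_eq_norm]
    exact hC.dist_le (hball (hBδ hx)).1 (hball (hBδ hy)).1
  · refine (ContinuousLinearMap.opNorm_comp_le _ _).trans ?_
    calc ‖fderiv ℝ h (u x) - fderiv ℝ h (u y)‖ * ‖fderiv ℝ u y‖
        ≤ (Q * (N * dist x y)) * N := by
          refine mul_le_mul ((hhlip _ _).trans ?_) (hNb y hy) (norm_nonneg _) (by positivity)
          rw [dist_eq_norm]
          exact mul_le_mul_of_nonneg_left (hlip x hx y hy) hQ0
      _ = Q * N * N * dist x y := by ring
      _ ≤ Q * N * N * dist x y ^ (α : ℝ) := by gcongr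

end Holder

namespace DivForm

/-! ### Functions of `v`, extended by zero -/

section RadialFunctions

variable {n : ℕ} {M : Type*} [TopologicalSpace M]
  {F : Type*} [NormedAddCommGroup F]

/-- The function `h ∘ v` outside the set `K₁`, extended by zero. -/
noncomputable def radial (K₁ : Set M) (v : M → ℝ) (h : ℝ → F) : M → F := K₁ᶜ.indicator fun x => h (v x)

/-- `K₁` is a closed neighbourhood of the closed set `K`, and `v < R` on its boundary, for a
function `v` that is continuous outside `K`. -/
structure IsCollar (K K₁ : Set M) (v : M → ℝ) (R : ℝ) : Prop where
  isClosed : IsClosed K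
  isClosed_nhd : IsClosed K₁
  subset_interior : K ⊆ interior K₁
  continuousOn : ContinuousOn v Kᶜ
  lt_of_mem_frontier : ∀ x ∈ frontier K₁, v x < R

namespace IsCollar

variable {K K₁ : Set M} {v : M → ℝ} {R : ℝ} {h : ℝ → F}

theorem mem_compl (hK : IsCollar K K₁ v R) {x : M} (hx : x ∉ interior K₁) : x ∈ Kᶜ :=
  fun h => hx (hK.subset_interior h)

theorem continuousAt (hK : IsCollar K K₁ v R) {x : M} (hx : x ∉ interior K₁) :
    ContinuousAt v x :=
  hK.continuousOn.continuousAt (hK.isClosed.isOpen_compl.mem_nhds (hK.mem_compl hx))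

theorem radial_eventuallyEq_zero {x : M} (hx : x ∈ interior K₁) :
    radial K₁ v h =ᶠ[𝓝 x] fun _ => (0 : F) := by
  filter_upwards [isOpen_interior.mem_nhds hx] with y hy
  exact Set.indicator_of_notMem (Set.notMem_compl_iff.2 (interior_subset hy)) _

/-- The only delicate points lie on the frontier of `K₁`. There `v < R`, and this persists nearby by
continuity, so both functions vanish in a neighbourhood and the truncation leaves no trace. -/
theorem radial_eventuallyEq (hK : IsCollar K K₁ v R) (hh : ∀ r < R, h r = 0) {x : M}
    (hx : x ∉ interior K₁) : radial K₁ v h =ᶠ[𝓝 x] h ∘ v := by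
  by_cases hx₁ : x ∈ K₁
  · have hlt : v x < R := hK.lt_of_mem_frontier x ⟨subset_closure hx₁, hx⟩
    filter_upwards [(hK.continuousAt hx).eventually (gt_mem_nhds hlt)] with y hy
    rw [Function.comp_apply, hh _ hy, radial]
    by_cases hy₁ : y ∈ K₁
    · exact Set.indicator_of_notMem (Set.notMem_compl_iff.2 hy₁) _
    · rw [Set.indicator_of_mem hy₁, hh _ hy]
  · filter_upwards [hK.isClosed_nhd.isOpen_compl.mem_nhds hx₁] with y hy
    exact Set.indicator_of_mem hy _

theorem radial_apply (hK : IsCollar K K₁ v R) (hh : ∀ r < R, h r = 0) {x : M}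
    (hx : x ∉ interior K₁) : radial K₁ v h x = h (v x) :=
  (hK.radial_eventuallyEq hh hx).self_of_nhds

theorem radial_apply_of_mem_interior {x : M} (hx : x ∈ interior K₁) : radial K₁ v h x = 0 :=
  radial_eventuallyEq_zero hx |>.self_of_nhds

/-- The shell `{R ≤ v ≤ S}`. -/
def _root_.DivForm.shell (K₁ : Set M) (v : M → ℝ) (R S : ℝ) : Set M :=
  (interior K₁)ᶜ ∩ v ⁻¹' Set.Icc R S

theorem isClosed_shell (hK : IsCollar K K₁ v R) (S : ℝ) : IsClosed (shell K₁ v R S) :=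
  (hK.continuousOn.mono fun _ hx => hK.mem_compl hx).preimage_isClosed_of_isClosed
    isOpen_interior.isClosed_compl isClosed_Icc

/-- Since `v` tends to infinity, `{v ≤ S}` lies in a compact set. -/
theorem isCompact_shell (hK : IsCollar K K₁ v R) (hinf : Tendsto v (cocompact M) atTop) (S : ℝ) :
    IsCompact (shell K₁ v R S) := by
  obtain ⟨t, ht, hts⟩ := mem_cocompact.1 (hinf.eventually_gt_atTop S)
  refine ht.of_isClosed_subset (hK.isClosed_shell S) fun _ hx => ?_
  by_contra hxt
  exact absurd hx.2.2 (not_le.2 (hts hxt))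

theorem shell_subset_compl (hK : IsCollar K K₁ v R) (S : ℝ) : shell K₁ v R S ⊆ Kᶜ :=
  fun _ hx => hK.mem_compl hx.1

theorem notMem_of_mem_shell (hK : IsCollar K K₁ v R) {S : ℝ} {x : M} (hx : x ∈ shell K₁ v R S) :
    x ∉ K₁ := fun h =>
  absurd hx.2.1 (not_le.2 (hK.lt_of_mem_frontier x ⟨subset_closure h, hx.1⟩))

theorem radial_eq_zero (hK : IsCollar K K₁ v R) {S : ℝ} (hh : ∀ r ∉ Set.Icc R S, h r = 0) {x : M}
    (hx : x ∉ shell K₁ v R S) : radial K₁ v h x = 0 := by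
  by_cases hx₁ : x ∈ interior K₁
  · exact radial_apply_of_mem_interior hx₁
  · rw [hK.radial_apply (fun r hr => hh r fun h => absurd h.1 (not_le.2 hr)) hx₁]
    exact hh _ fun h => hx ⟨hx₁, h⟩

theorem tsupport_radial_subset (hK : IsCollar K K₁ v R) {S : ℝ} (hh : ∀ r ∉ Set.Icc R S, h r = 0) :
    tsupport (radial K₁ v h) ⊆ shell K₁ v R S :=
  closure_minimal (fun _ hx => by_contra fun hn => hx (hK.radial_eq_zero hh hn))
    (hK.isClosed_shell S)

variable [ChartedSpace (EuclideanSpace ℝ (Fin n)) M] [NormedSpace ℝ F]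

theorem contMDiff_radial (hK : IsCollar K K₁ v R) (hh : ∀ r < R, h r = 0) {m : ℕ∞}
    (hsm : ContDiff ℝ m h) (hv : ContMDiffOn (𝓡 n) 𝓘(ℝ, ℝ) m v Kᶜ) :
    ContMDiff (𝓡 n) 𝓘(ℝ, F) m (radial K₁ v h) := by
  intro x
  by_cases hx : x ∈ interior K₁
  · exact contMDiffAt_const.congr_of_eventuallyEq (radial_eventuallyEq_zero hx)
  · have hxK := hK.mem_compl hx
    exact (hsm.contMDiff.contMDiffAt.comp x ((hv x hxK).contMDiffAt
      (hK.isClosed.isOpen_compl.mem_nhds hxK))).congr_of_eventuallyEq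
      (hK.radial_eventuallyEq hh hx)

theorem isC1HolderOn_radial [IsManifold (𝓡 n) ∞ M] (hK : IsCollar K K₁ v R)
    (hh : ∀ r < R, h r = 0) (hsm : ContDiff ℝ 2 h) (hc : HasCompactSupport h) {α : ℝ≥0}
    (hα1 : α ≤ 1) (hv : IsC1HolderOn (n := n) α v Kᶜ) :
    IsC1HolderOn (n := n) α (radial K₁ v h) Set.univ := by
  refine ⟨(hK.contMDiff_radial hh (m := 1) (hsm.of_le (by norm_num)) hv.1).contMDiffOn,
    fun x _ => ?_⟩
  have htend : Tendsto (extChartAt (𝓡 n) x).symm (𝓝 (extChartAt (𝓡 n) x x)) (𝓝 x) := by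
    have := continuousAt_extChartAt_symm (I := 𝓡 n) x
    rwa [ContinuousAt, extChartAt_to_inv] at this
  have hcongr : ∀ p : M → F, radial K₁ v h =ᶠ[𝓝 x] p →
      (∃ W ∈ 𝓝 (extChartAt (𝓡 n) x x), ∃ C : ℝ≥0,
        HolderOnWith C α (fderiv ℝ (p ∘ (extChartAt (𝓡 n) x).symm)) W) →
      ∃ W ∈ 𝓝 (extChartAt (𝓡 n) x x), ∃ C : ℝ≥0,
        HolderOnWith C α (fderiv ℝ (radial K₁ v h ∘ (extChartAt (𝓡 n) x).symm)) W := by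
    rintro p hp ⟨W, hW, C, hC⟩
    have hp' : radial K₁ v h ∘ (extChartAt (𝓡 n) x).symm =ᶠ[𝓝 (extChartAt (𝓡 n) x x)]
        p ∘ (extChartAt (𝓡 n) x).symm := htend.eventually hp
    refine ⟨_, Filter.inter_mem hW (hp'.fderiv (𝕜 := ℝ)), C, ?_⟩
    intro y hy z hz
    have h1 : fderiv ℝ (radial K₁ v h ∘ (extChartAt (𝓡 n) x).symm) y =
      fderiv ℝ (p ∘ (extChartAt (𝓡 n) x).symm) y := hy.2
    have h2 : fderiv ℝ (radial K₁ v h ∘ (extChartAt (𝓡 n) x).symm) z =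
      fderiv ℝ (p ∘ (extChartAt (𝓡 n) x).symm) z := hz.2
    rw [h1, h2]
    exact hC y hy.1 z hz.1
  by_cases hx : x ∈ interior K₁
  · refine hcongr _ (radial_eventuallyEq_zero hx) ⟨Set.univ, univ_mem, 0, ?_⟩
    have : fderiv ℝ ((fun _ : M => (0 : F)) ∘ (extChartAt (𝓡 n) x).symm) =
        fun _ => (0 : EuclideanSpace ℝ (Fin n) →L[ℝ] F) := by
      ext1 z; exact fderiv_const_apply _
    rw [this]
    exact fun _ _ _ _ => by simp
  · have hxK := hK.mem_compl hx
    refine hcongr _ (hK.radial_eventuallyEq hh hx)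
      (exists_holderOnWith_fderiv_comp hα1 hsm hc ?_ (hv.2 x hxK))
    have hO := isOpen_extChartAt_target_inter_preimage (n := n) x hK.isClosed.isOpen_compl
    have hcd : ContDiffOn ℝ 1 _ _ := contDiffOn_comp_extChartAt_symm (m := 1) hv.1 x
    filter_upwards [hO.mem_nhds ⟨mem_extChartAt_target x, by
      rwa [Set.mem_preimage, extChartAt_to_inv]⟩] with z hz
    exact (hcd.differentiableOn one_ne_zero).differentiableAt (hO.mem_nhds hz)

/-- The formula holds at every point: in the interior of `K₁`, where `v` may be irregular, both
sides vanish. -/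
theorem differential_radial {h : ℝ → ℝ} (hK : IsCollar K K₁ v R) (hh : ∀ r < R, h r = 0)
    (hsm : ContDiff ℝ 1 h) (hv : ContMDiffOn (𝓡 n) 𝓘(ℝ, ℝ) 1 v Kᶜ) (x : M) :
    differential (n := n) (radial K₁ v h) x = radial K₁ v (deriv h) x • differential v x := by
  by_cases hx : x ∈ interior K₁
  · rw [radial_apply_of_mem_interior hx, zero_smul]
    exact (radial_eventuallyEq_zero hx).mfderiv_eq.trans (mfderiv_const (I := 𝓡 n))
  · have hxK := hK.mem_compl hx
    have hh' : ∀ r < R, deriv h r = 0 := fun r hr => by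
      have : h =ᶠ[𝓝 r] fun _ => 0 := by
        filter_upwards [gt_mem_nhds hr] with s hs using hh s hs
      rw [this.deriv_eq, deriv_const]
    rw [hK.radial_apply hh' hx]
    have hvd : MDifferentiableAt (𝓡 n) 𝓘(ℝ, ℝ) v x := ((hv x hxK).contMDiffAt
      (hK.isClosed.isOpen_compl.mem_nhds hxK)).mdifferentiableAt one_ne_zero
    have hhd : HasMFDerivAt 𝓘(ℝ, ℝ) 𝓘(ℝ, ℝ) h (v x) (fderiv ℝ h (v x)) :=
      ((hsm.differentiable one_ne_zero) _).hasFDerivAt.hasMFDerivAt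
    refine (hK.radial_eventuallyEq hh hx).mfderiv_eq.trans
      ((HasMFDerivAt.comp x hhd hvd.hasMFDerivAt).mfderiv.trans ?_)
    ext w
    change fderiv ℝ h (v x) (differential v x w) = deriv h (v x) * differential v x w
    rw [fderiv_eq_smul_deriv, smul_eq_mul, mul_comm]

end IsCollar

end RadialFunctions

end DivForm

/-! ### The operator applied to functions of `v` -/

theorem deriv_eq_zero_of_notMem_Icc {F : Type*} [NormedAddCommGroup F] [NormedSpace ℝ F]
    {h : ℝ → F} {R S : ℝ} (hh : ∀ r ∉ Set.Icc R S, h r = 0) : ∀ r ∉ Set.Icc R S, deriv h r = 0 := by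
  intro r hr
  have : h =ᶠ[𝓝 r] fun _ => 0 := by
    filter_upwards [isClosed_Icc.isOpen_compl.mem_nhds hr] with s hs using hh s hs
  rw [this.deriv_eq, deriv_const]

theorem ContDiff.deriv_infty {F : Type*} [NormedAddCommGroup F] [NormedSpace ℝ F]
    {h : ℝ → F} (hh : ContDiff ℝ ∞ h) : ContDiff ℝ ∞ (deriv h) :=
  ((contDiff_infty_iff_deriv).1 hh).2

theorem deriv_re {h : ℝ → ℂ} (hh : Differentiable ℝ h) :
    deriv (fun r => (h r).re) = fun r => (deriv h r).re :=
  funext fun r => (Complex.reCLM.hasFDerivAt.comp_hasDerivAt r (hh r).hasDerivAt).deriv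

theorem deriv_im {h : ℝ → ℂ} (hh : Differentiable ℝ h) :
    deriv (fun r => (h r).im) = fun r => (deriv h r).im :=
  funext fun r => (Complex.imCLM.hasFDerivAt.comp_hasDerivAt r (hh r).hasDerivAt).deriv

namespace DivForm

section RadialGraph

variable {n : ℕ} {M : Type*} [TopologicalSpace M] [ChartedSpace (EuclideanSpace ℝ (Fin n)) M]
  [MeasurableSpace M] {ν : Measure M} {A : CoeffField n M} {K K₁ : Set M} {v f : M → ℝ} {R S : ℝ}

/-- The function `L (h ∘ v) = h'(v) L v - h''(v) |∇v|²`, for `L v = f`. -/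
noncomputable def radialImage (A : CoeffField n M) (K₁ : Set M) (v f : M → ℝ) (h : ℝ → ℂ) (x : M) :
    ℂ :=
  radial K₁ v (deriv h) x * f x -
    radial K₁ v (deriv (deriv h)) x * (A x (differential v x) (differential v x) : ℝ)

variable [T2Space M] [SigmaCompactSpace M] [BorelSpace M] [IsManifold (𝓡 n) ∞ M]
  [IsLocallyFiniteMeasure ν]

/-- Since `d(h ∘ v) = h'(v) dv`, the product rule gives `⟨A∇(h ∘ v), ∇ζ⟩ = ⟨A∇v, ∇(h'(v) ζ)⟩ -
h''(v) |∇v|² ζ`. The weak equation tested with `h'(v) ζ` evaluates the first term. Integrability is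
recorded so that real and imaginary parts can be recombined later. -/
theorem IsWeakSolutionOn.form_radial (hA : IsElliptic ν A) (hK : IsCollar K K₁ v R)
    (hv : ContMDiffOn (𝓡 n) 𝓘(ℝ, ℝ) 1 v Kᶜ) (hinf : Tendsto v (cocompact M) atTop)
    (hsol : IsWeakSolutionOn ν A Kᶜ v f) {h : ℝ → ℝ} (hh : ContDiff ℝ ∞ h)
    (hz : ∀ r ∉ Set.Icc R S, h r = 0) {ζ : M → ℝ} (hζ : IsTestFunction n Set.univ ζ) :
    Integrable (fun x => (radial K₁ v (deriv h) x * f x - radial K₁ v (deriv (deriv h)) x *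
      A x (differential v x) (differential v x)) * ζ x) ν ∧
    form ν A (radial K₁ v h) ζ = ∫ x, (radial K₁ v (deriv h) x * f x -
      radial K₁ v (deriv (deriv h)) x * A x (differential v x) (differential v x)) * ζ x ∂ν := by
  have hz1 := deriv_eq_zero_of_notMem_Icc hz
  have hlow : ∀ p : ℝ → ℝ, (∀ r ∉ Set.Icc R S, p r = 0) → ∀ r < R, p r = 0 :=
    fun p hp r hr => hp r fun h => absurd h.1 (not_le.2 hr)
  have hh1 := hh.deriv_infty
  have hζ1 : ContMDiff (𝓡 n) 𝓘(ℝ, ℝ) 1 ζ := hζ.1.of_le (by simp)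
  set p := radial K₁ v (deriv h) with hp
  have hpsm : ContMDiff (𝓡 n) 𝓘(ℝ, ℝ) 1 p :=
    hK.contMDiff_radial (hlow _ hz1) (m := 1) (hh1.of_le (by simp)) hv
  have hD := hK.isCompact_shell hinf S
  have hpD : tsupport p ⊆ shell K₁ v R S := hK.tsupport_radial_subset hz1
  have hDK := hK.shell_subset_compl S
  have hKo := hK.isClosed.isOpen_compl
  have hpζ : ContMDiff (𝓡 n) 𝓘(ℝ, ℝ) 1 (p * ζ) := hpsm.mul hζ1
  have hpζD : tsupport (p * ζ) ⊆ shell K₁ v R S := (tsupport_mul_subset_left).trans hpD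
  have hpζc : HasCompactSupport (p * ζ) := hD.of_isClosed_subset (isClosed_tsupport _) hpζD
  have hF1 : Integrable (fun x => A x (differential (radial K₁ v h) x) (differential ζ x)) ν :=
    hA.integrable_pairing isOpen_univ
      (hK.contMDiff_radial (hlow _ hz) (m := 1) (hh.of_le (by simp)) hv).contMDiffOn
      hζ1.contMDiffOn hζ.2.1 (Set.subset_univ _)
  have hF2 : Integrable (fun x => A x (differential v x) (differential (p * ζ) x)) ν :=
    hA.integrable_pairing hKo hv hpζ.contMDiffOn hpζc (hpζD.trans hDK)
  have hF3 : Integrable (fun x => f x * (p * ζ) x) ν := by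
    rw [← integrableOn_iff_integrable_of_support_subset (s := shell K₁ v R S)]
    · exact (hsol.1.integrableOn hD hDK).mul_continuousOn hpζ.continuous.continuousOn hD
    · intro x hx
      exact hpζD (subset_tsupport _ (right_ne_zero_of_mul hx))
  have hident : ∀ x, (p x * f x - radial K₁ v (deriv (deriv h)) x *
      A x (differential v x) (differential v x)) * ζ x = f x * (p * ζ) x -
      (A x (differential v x) (differential (p * ζ) x) -
        A x (differential (radial K₁ v h) x) (differential ζ x)) := by
    intro x
    rw [differential_mul ((hpsm.mdifferentiable one_ne_zero) x)
      ((hζ1.mdifferentiable one_ne_zero) x),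
      hK.differential_radial (hlow _ hz) (hh.of_le (by simp)) hv,
      hK.differential_radial (hlow _ hz1) (hh1.of_le (by simp)) hv, ← hp]
    simp only [map_add, map_smul, LinearMap.smul_apply, smul_eq_mul, Pi.mul_apply]
    ring
  have hF : Integrable (fun x => A x (differential v x) (differential (p * ζ) x) -
      A x (differential (radial K₁ v h) x) (differential ζ x)) ν := hF2.sub hF1
  simp only [hident]
  refine ⟨hF3.sub hF, ?_⟩
  rw [integral_sub hF3 hF, integral_sub hF2 hF1,
    ← hsol.form_eq hA hKo hv hpζ hpζc (hpζD.trans hDK)]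
  simp only [form]
  ring

/-- The real identity is applied to the real and imaginary parts of `h`. The image is in `L²`
because it is essentially bounded and vanishes off the compact shell. -/
theorem IsWeakSolutionOn.friedrichsGraph_radial (hA : IsElliptic ν A) (hK : IsCollar K K₁ v R)
    (hv : ContMDiffOn (𝓡 n) 𝓘(ℝ, ℝ) 1 v Kᶜ) (hinf : Tendsto v (cocompact M) atTop)
    (hsol : IsWeakSolutionOn ν A Kᶜ v f) {h : ℝ → ℂ} (hh : ContDiff ℝ ∞ h)
    (hz : ∀ r ∉ Set.Icc R S, h r = 0) :
    FriedrichsGraph ν A (radial K₁ v h) (radialImage A K₁ v f h) := by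
  have hlow : ∀ p : ℝ → ℂ, (∀ r ∉ Set.Icc R S, p r = 0) → ∀ r < R, p r = 0 :=
    fun p hp r hr => hp r fun h => absurd h.1 (not_le.2 hr)
  have hz1 := deriv_eq_zero_of_notMem_Icc hz
  have hz2 := deriv_eq_zero_of_notMem_Icc hz1
  have hh1 := hh.deriv_infty
  have hh2 := hh1.deriv_infty
  have hsm : ∀ p : ℝ → ℂ, ContDiff ℝ ∞ p → (∀ r ∉ Set.Icc R S, p r = 0) →
      ContMDiff (𝓡 n) 𝓘(ℝ, ℂ) 1 (radial K₁ v p) := fun p hp hpz =>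
    hK.contMDiff_radial (hlow _ hpz) (m := 1) (hp.of_le (by simp)) hv
  have hD := hK.isCompact_shell hinf S
  have hDK := hK.shell_subset_compl S
  have hKo := hK.isClosed.isOpen_compl
  have hcs : ∀ p : ℝ → ℂ, (∀ r ∉ Set.Icc R S, p r = 0) → HasCompactSupport (radial K₁ v p) :=
    fun p hp => hD.of_isClosed_subset (isClosed_tsupport _) (hK.tsupport_radial_subset hp)
  have hre : ∀ p : ℝ → ℂ, (fun x => (radial K₁ v p x).re) = radial K₁ v fun r => (p r).re := by
    intro p; ext x
    by_cases hx : x ∈ K₁ᶜ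
    · rw [radial, radial, Set.indicator_of_mem hx, Set.indicator_of_mem hx]
    · rw [radial, radial, Set.indicator_of_notMem hx, Set.indicator_of_notMem hx, Complex.zero_re]
  have him : ∀ p : ℝ → ℂ, (fun x => (radial K₁ v p x).im) = radial K₁ v fun r => (p r).im := by
    intro p; ext x
    by_cases hx : x ∈ K₁ᶜ
    · rw [radial, radial, Set.indicator_of_mem hx, Set.indicator_of_mem hx]
    · rw [radial, radial, Set.indicator_of_notMem hx, Set.indicator_of_notMem hx, Complex.zero_im]
  refine ⟨(hsm h hh hz).continuous.memLp_of_hasCompactSupport (hcs h hz), ?_, ?_⟩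
  · have hind : (shell K₁ v R S).indicator (radialImage A K₁ v f h) = radialImage A K₁ v f h := by
      refine Set.indicator_eq_self.2 fun x hx => by_contra fun hn => hx ?_
      rw [radialImage, hK.radial_eq_zero hz1 hn, hK.radial_eq_zero hz2 hn, zero_mul, zero_mul,
        sub_zero]
    rw [← hind, memLp_indicator_iff_restrict hD.measurableSet]
    have : IsFiniteMeasure (ν.restrict (shell K₁ v R S)) :=
      isFiniteMeasure_restrict.2 hD.measure_lt_top.ne
    obtain ⟨P, hP⟩ := (hsm _ hh1 hz1).continuous.bounded_above_of_compact_support (hcs _ hz1)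
    obtain ⟨Q, hQ⟩ := (hsm _ hh2 hz2).continuous.bounded_above_of_compact_support (hcs _ hz2)
    obtain ⟨B, hB⟩ := hsol.1.exists_bound hD hDK
    obtain ⟨a, ha0, ha⟩ := hA.exists_bound_of_isCompact hKo hv hD hDK
    have hmono := Measure.restrict_mono (μ := ν) hDK le_rfl
    refine MemLp.of_bound ?_ (P * |B| + Q * a) ?_
    · refine ((hsm _ hh1 hz1).continuous.aestronglyMeasurable.mul
        (Complex.continuous_ofReal.comp_aestronglyMeasurable (hsol.1.1.mono_measure hmono))).sub
        ((hsm _ hh2 hz2).continuous.aestronglyMeasurable.mul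
        (Complex.continuous_ofReal.comp_aestronglyMeasurable
          ((hA.aemeasurable_pairing hKo hv hv).mono_measure hmono).aestronglyMeasurable))
    · filter_upwards [hB, ae_restrict_mem hD.measurableSet] with x hx hxD
      have hP0 : 0 ≤ P := (norm_nonneg _).trans (hP x)
      have hQ0 : 0 ≤ Q := (norm_nonneg _).trans (hQ x)
      refine (norm_sub_le _ _).trans (add_le_add ?_ ?_)
      · rw [norm_mul, Complex.norm_real]
        exact mul_le_mul (hP x) (hx.trans (le_abs_self B)) (norm_nonneg _) hP0
      · rw [norm_mul, Complex.norm_real, Real.norm_of_nonneg (hA.nonneg x _)]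
        exact mul_le_mul (hQ x) (ha x hxD) (hA.nonneg x _) hQ0
  · obtain ⟨w, hw, hlim⟩ := hA.exists_formConverges (hsm h hh hz) (hcs h hz)
    refine ⟨w, hw, fun ζ hζ => ?_⟩
    have hdiff := hh.differentiable (by simp)
    have hdiff1 := hh1.differentiable (by simp)
    have hr := hsol.form_radial (S := S) hA hK hv hinf
      (h := fun r => (h r).re) (Complex.reCLM.contDiff.comp hh)
      (fun r hr => by rw [hz r hr, Complex.zero_re]) hζ
    have hi := hsol.form_radial (S := S) hA hK hv hinf
      (h := fun r => (h r).im) (Complex.imCLM.contDiff.comp hh)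
      (fun r hr => by rw [hz r hr, Complex.zero_im]) hζ
    rw [deriv_re hdiff, deriv_re hdiff1, ← hre, ← hre, ← hre] at hr
    rw [deriv_im hdiff, deriv_im hdiff1, ← him, ← him, ← him] at hi
    have heq : complexForm ν A (radial K₁ v h) ζ =
        ∫ x, radialImage A K₁ v f h x * (ζ x : ℂ) ∂ν := by
      rw [complexForm, hr.2, hi.2, ← integral_complex_ofReal, ← integral_complex_ofReal,
        ← integral_const_mul, ← integral_add hr.1.ofReal (hi.1.ofReal.const_mul _)]
      refine integral_congr_ae (Eventually.of_forall fun x => ?_)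
      refine Complex.ext ?_ ?_ <;> simp [radialImage]
    rw [← heq]
    exact hlim ζ hζ

end RadialGraph

/-! ### Weyl sequences at infinity -/

section WeylSequence

variable {n : ℕ} {M : Type*} [TopologicalSpace M] [ChartedSpace (EuclideanSpace ℝ (Fin n)) M]
  [MeasurableSpace M] {ν : Measure M} {A : CoeffField n M} {K K₁ : Set M} {v f : M → ℝ}

theorem IsElliptic.gradNorm_sq (hA : IsElliptic ν A) (u : M → ℝ) (x : M) :
    gradNorm A u x ^ 2 = A x (differential u x) (differential u x) :=
  Real.sq_sqrt (hA.nonneg x _)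

theorem map_restrict_compl_apply [BorelSpace M] (hK₁ : IsClosed K₁) {U : Set M}
    (hU : K₁ᶜ ⊆ U) (hv : ContinuousOn v U) {B : Set ℝ} (hB : MeasurableSet B) :
    Measure.map v (ν.restrict K₁ᶜ) B = ν (v ⁻¹' B ∩ K₁ᶜ) := by
  rw [Measure.map_apply_of_aemeasurable
    ((hv.mono hU).aemeasurable hK₁.measurableSet.compl) hB,
    Measure.restrict_apply' hK₁.measurableSet.compl]

theorem pushforward_apply [BorelSpace M] (hK : IsClosed K) (hv : ContinuousOn v Kᶜ) {B : Set ℝ}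
    (hB : MeasurableSet B) : pushforward ν K v B = ν (v ⁻¹' (B ∩ Set.Ici 0) ∩ Kᶜ) := by
  rw [pushforward, Measure.restrict_apply hB,
    map_restrict_compl_apply hK le_rfl hv (hB.inter measurableSet_Ici)]

theorem measure_preimage_Icc_lt_top [IsLocallyFiniteMeasure ν]
    (hinf : Tendsto v (cocompact M) atTop) (a b : ℝ) (U : Set M) :
    ν (v ⁻¹' Set.Icc a b ∩ U) < ⊤ := by
  obtain ⟨t, ht, hts⟩ := mem_cocompact.1 (hinf.eventually_gt_atTop b)
  refine (measure_mono fun x hx => ?_).trans_lt ht.measure_lt_top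
  by_contra hxt
  exact absurd hx.1.2 (not_le.2 (hts hxt))

/-- Here `a` stands for `|∇v|²`, `b` for `f`, and `h, h₁, h₂` for the profile and its derivatives at
one point. Writing the error as `h₁ b - (h₂ + λ² h) a + λ² h (a - C²)` isolates one small factor in
each term. -/
theorem norm_radialImage_sub_le {a b c C lam ε : ℝ} {h h₁ h₂ : ℂ} (hε : 0 < ε) (hε1 : ε ≤ 1)
    (hlam : 0 ≤ lam) (hb : |b| ≤ ε) (ha : |a - C ^ 2| ≤ ε) (hh : ‖h‖ ≤ 1) (hh₁ : ‖h₁‖ ≤ ε + lam)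
    (hh₂ : ‖h₂ + (lam : ℂ) ^ 2 * h‖ ≤ (1 + 2 * lam) * ε) (hc : c = lam ^ 2 * C ^ 2) :
    ‖h₁ * b - h₂ * a - c * h‖ ≤ ((1 + lam) + (1 + 2 * lam) * (C ^ 2 + 1) + lam ^ 2) * ε := by
  have hsplit : h₁ * b - h₂ * a - c * h =
      h₁ * b - (h₂ + (lam : ℂ) ^ 2 * h) * a + (lam : ℂ) ^ 2 * h * ((a - C ^ 2 : ℝ) : ℂ) := by
    rw [hc]; push_cast; ring
  have hab : |a| ≤ C ^ 2 + 1 := by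
    have h1 := abs_add_le (a - C ^ 2) (C ^ 2)
    rw [sub_add_cancel, abs_of_nonneg (sq_nonneg C)] at h1
    linarith
  rw [hsplit]
  have h1 : ‖h₁ * b‖ ≤ (1 + lam) * ε := by
    rw [norm_mul, Complex.norm_real]
    exact mul_le_mul (hh₁.trans (by linarith)) hb (norm_nonneg _) (by linarith)
  have h2 : ‖(h₂ + (lam : ℂ) ^ 2 * h) * a‖ ≤ (1 + 2 * lam) * ε * (C ^ 2 + 1) := by
    rw [norm_mul, Complex.norm_real]
    exact mul_le_mul hh₂ hab (norm_nonneg _) (by positivity)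
  have h3 : ‖(lam : ℂ) ^ 2 * h * ((a - C ^ 2 : ℝ) : ℂ)‖ ≤ lam ^ 2 * ε := by
    rw [norm_mul, norm_mul, norm_pow, Complex.norm_real, Complex.norm_real,
      Real.norm_of_nonneg hlam]
    exact mul_le_mul (mul_le_of_le_one_right (by positivity) hh) ha (norm_nonneg _) (by positivity)
  calc _ ≤ ‖h₁ * b‖ + ‖(h₂ + (lam : ℂ) ^ 2 * h) * a‖ + _ :=
        (norm_add_le _ _).trans (add_le_add_left (norm_sub_le _ _) _)
    _ ≤ (1 + lam) * ε + (1 + 2 * lam) * ε * (C ^ 2 + 1) + lam ^ 2 * ε :=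
        add_le_add (add_le_add h1 h2) h3
    _ = _ := by ring

variable [T2Space M] [SigmaCompactSpace M] [BorelSpace M] [IsManifold (𝓡 n) ∞ M]
  [IsLocallyFiniteMeasure ν]

theorem IsElliptic.exists_weyl_function (hA : IsElliptic ν A) (hK : IsCompact K) {α : ℝ≥0}
    (hα1 : α ≤ 1) (hv : IsC1HolderOn (n := n) α v Kᶜ) {C : ℝ} (hC : 0 < C)
    (hgrad : Tendsto (gradNorm A v) (cocompact M) (𝓝 C)) (hinf : Tendsto v (cocompact M) atTop)
    (hsol : IsWeakSolutionOn ν A Kᶜ v f) (hf : Tendsto f (cocompact M) (𝓝 0))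
    (hχ : IsClassC (pushforward ν K v)) (hσ : growthRate (pushforward ν K v) = 0)
    {η : ℝ} (hη : 0 ≤ η) :
    ∃ Λ : ℝ, ∀ ε : ℝ, 0 < ε → ε ≤ 1 → ∀ Q : Set M, IsCompact Q → ∃ φ g : M → ℂ,
      (IsC1HolderOn (n := n) α φ Set.univ ∧ HasCompactSupport φ) ∧
      (∀ m : ℕ∞, ContMDiffOn (𝓡 n) 𝓘(ℝ, ℝ) m v Kᶜ → ContMDiff (𝓡 n) 𝓘(ℝ, ℂ) m φ) ∧
      (eLpNorm φ 2 ν ≠ 0 ∧ FriedrichsGraph ν A φ g) ∧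
      eLpNorm (fun x => g x - (η : ℂ) * φ x) 2 ν / eLpNorm φ 2 ν ≤ ENNReal.ofReal (Λ * ε) ∧
      tsupport φ ⊆ Qᶜ := by
  have : LocallyCompactSpace M := Manifold.locallyCompact_of_finiteDimensional (𝓡 n)
  -- The frequency for which `-C² d²/dr²` has `exp(i lam r)` as eigenfunction with eigenvalue `η`.
  set lam := √η / C with hlam
  have hlam0 : 0 ≤ lam := by positivity
  have hηC : η = lam ^ 2 * C ^ 2 := by
    rw [hlam, div_pow, Real.sq_sqrt hη]; field_simp
  set Λ := (1 + lam) + (1 + 2 * lam) * (C ^ 2 + 1) + lam ^ 2 with hΛ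
  have hΛ0 : 0 ≤ Λ := by positivity
  -- The factor 2 is the square root of the mass ratio 4 between the shell and the set where `|φ| =
  -- 1`.
  refine ⟨2 * Λ, fun ε hε hε1 Q hQ => ?_⟩
  obtain ⟨K₁, hK₁, hKK₁⟩ := exists_compact_superset hK
  have hvc : ContinuousOn v Kᶜ := hv.1.continuousOn
  have hfar : ∀ᶠ x in cocompact M,
      |A x (differential v x) (differential v x) - C ^ 2| ≤ ε ∧ |f x| ≤ ε := by
    have h1 := (hgrad.pow 2).eventually (Metric.closedBall_mem_nhds (C ^ 2) hε)
    have h2 := hf.eventually (Metric.closedBall_mem_nhds 0 hε)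
    filter_upwards [h1, h2] with x hx1 hx2
    rw [Real.dist_eq, hA.gradNorm_sq] at hx1
    rw [Real.dist_eq, sub_zero] at hx2
    exact ⟨hx1, hx2⟩
  obtain ⟨t, ht, hts⟩ := mem_cocompact.1 hfar
  -- The region to be avoided: where the asymptotics may fail, the prescribed `Q`, and `K₁`.
  -- Removing the interior of `K₁` leaves a compact set on which `v` is continuous, hence bounded,
  -- and `R` is taken above that bound.
  set T := (t ∪ Q ∪ K₁) ∩ (interior K₁)ᶜ with hT
  have hTc : IsCompact T := ((ht.union hQ).union hK₁).inter_right isOpen_interior.isClosed_compl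
  have hTK : T ⊆ Kᶜ := fun x hx h => hx.2 (hKK₁ h)
  obtain ⟨R₀, hR₀⟩ := hTc.exists_bound_of_continuousOn (hvc.mono hTK)
  set R := |R₀| + 1 with hR
  have hR0 : 0 ≤ R := by positivity
  have hRT : ∀ x ∈ T, v x < R := fun x hx => by
    have h1 := (Real.le_norm_self _).trans (hR₀ x hx)
    have h2 := le_abs_self R₀
    linarith
  have hcol : IsCollar K K₁ v R := ⟨hK.isClosed, hK₁.isClosed, hKK₁, hvc, fun x hx =>
    hRT x ⟨Or.inr (hK₁.isClosed.frontier_subset hx), hx.2⟩⟩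
  have hshellT : ∀ S x, x ∈ shell K₁ v R S → x ∉ t ∧ x ∉ Q := fun S x hx => by
    have hx' : x ∉ T := fun h => absurd (hRT x h) (not_lt.2 hx.2.1)
    exact ⟨fun h => hx' ⟨Or.inl (Or.inl h), hx.1⟩, fun h => hx' ⟨Or.inl (Or.inr h), hx.1⟩⟩
  have hKsub : K₁ᶜ ⊆ Kᶜ := Set.compl_subset_compl.2 (hKK₁.trans interior_subset)
  -- The relevant mass is that off `K₁`, where the radial functions live. On `[0, r]` it is at most
  -- that of the given push-forward, and its total mass stays infinite because `K₁` has finite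
  -- measure.
  set χ := Measure.map v (ν.restrict K₁ᶜ) with hχdef
  have hχap : ∀ B, MeasurableSet B → χ B = ν (v ⁻¹' B ∩ K₁ᶜ) := fun B hB =>
    map_restrict_compl_apply hK₁.isClosed hKsub hvc hB
  have hle : ∀ r, χ (Set.Icc 0 r) ≤ pushforward ν K v (Set.Icc 0 r) := by
    intro r
    rw [hχap _ measurableSet_Icc, pushforward_apply hK.isClosed hvc measurableSet_Icc]
    exact measure_mono fun x hx => ⟨⟨hx.1, hx.1.1⟩, hKsub hx.2⟩
  have hχinf : χ (Set.Ici 0) = ⊤ := by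
    have h1 := hχ.infinite
    rw [pushforward_apply hK.isClosed hvc MeasurableSet.univ, Set.univ_inter] at h1
    by_contra hne
    rw [hχap _ measurableSet_Ici] at hne
    have h2 : ν (v ⁻¹' Set.Ici 0 ∩ Kᶜ) ≤ ν (v ⁻¹' Set.Ici 0 ∩ K₁ᶜ) + ν K₁ := by
      refine (measure_mono fun x hx => ?_).trans (measure_union_le _ _)
      by_cases hx₁ : x ∈ K₁
      · exact Or.inr hx₁
      · exact Or.inl ⟨hx.1, hx₁⟩
    rw [h1] at h2
    exact absurd h2 (not_le.2 (ENNReal.add_lt_top.2 ⟨lt_top_iff_ne_top.2 hne, hK₁.measure_lt_top⟩))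
  obtain ⟨S, h, hsm, hz, hh, hh₁, hh₂, hmass, hpos⟩ := exists_modulated_cutoff (χ := χ)
    (fun r => by
      rw [hχap _ measurableSet_Icc]; exact measure_preimage_Icc_lt_top hinf 0 r _) hχinf
    (fun δ hδ => (eventually_le_exp_of_growthRate_eq_zero hσ hδ).mono fun r hr => (hle r).trans hr)
    hR0 hε hlam0
  have hlow : ∀ p : ℝ → ℂ, (∀ r ∉ Set.Icc R S, p r = 0) → ∀ r < R, p r = 0 :=
    fun p hp r hr => hp r fun h => absurd h.1 (not_le.2 hr)
  have hz1 := deriv_eq_zero_of_notMem_Icc hz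
  have hz2 := deriv_eq_zero_of_notMem_Icc hz1
  set φ := radial K₁ v h with hφ
  set g := radialImage A K₁ v f h with hg
  have hts' : tsupport φ ⊆ shell K₁ v R S := hcol.tsupport_radial_subset hz
  have hφsm : ∀ m : ℕ∞, ContMDiffOn (𝓡 n) 𝓘(ℝ, ℝ) m v Kᶜ → ContMDiff (𝓡 n) 𝓘(ℝ, ℂ) m φ :=
    fun m hm => hcol.contMDiff_radial (hlow _ hz) (hsm.of_le (by exact_mod_cast le_top)) hm
  have hφc : Continuous φ := (hφsm 1 hv.1).continuous
  set D₁ := {x | ‖φ x‖ = 1} with hD₁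
  have hD₁m : MeasurableSet D₁ := (isClosed_eq hφc.norm continuous_const).measurableSet
  have hD₁le : χ {r | ‖h r‖ = 1} ≤ ν D₁ := by
    rw [hχap _ (isClosed_eq hsm.continuous.norm continuous_const).measurableSet]
    refine measure_mono fun x hx => ?_
    have : φ x = h (v x) := Set.indicator_of_mem hx.2 _
    rw [hD₁, Set.mem_ofPred_eq, this]
    exact hx.1
  have hDle : ν (shell K₁ v R S) ≤ 4 * ν D₁ := by
    refine le_trans ?_ (hmass.trans (mul_le_mul_right hD₁le 4))
    rw [hχap _ measurableSet_Icc]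
    exact measure_mono fun x hx => ⟨hx.2, hcol.notMem_of_mem_shell hx⟩
  have hlower : ν D₁ ^ (1 / 2 : ℝ) ≤ eLpNorm φ 2 ν := by
    have h1 : eLpNorm (D₁.indicator fun _ => (1 : ℂ)) 2 ν ≤ eLpNorm φ 2 ν := by
      refine eLpNorm_mono fun x => ?_
      by_cases hx : x ∈ D₁
      · rw [Set.indicator_of_mem hx, hx, norm_one]
      · rw [Set.indicator_of_notMem hx, norm_zero]; exact norm_nonneg _
    rw [eLpNorm_indicator_const hD₁m (by norm_num) (by norm_num)] at h1
    simpa using h1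
  have hφ0 : eLpNorm φ 2 ν ≠ 0 := by
    refine (lt_of_lt_of_le ?_ hlower).ne'
    exact ENNReal.rpow_pos_of_nonneg (hpos.trans_le hD₁le) (by norm_num)
  have hbound : eLpNorm (fun x => g x - (η : ℂ) * φ x) 2 ν ≤
      ν (shell K₁ v R S) ^ (1 / 2 : ℝ) * ENNReal.ofReal (Λ * ε) := by
    have hout : ∀ x ∉ shell K₁ v R S, g x - (η : ℂ) * φ x = 0 := fun x hx => by
      rw [hg, hφ, radialImage, hcol.radial_eq_zero hz hx, hcol.radial_eq_zero hz1 hx,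
        hcol.radial_eq_zero hz2 hx]
      simp
    refine eLpNorm_two_le_of_bound (fun x hx => by_contra fun hn => hx (hout x hn)) fun x => ?_
    by_cases hx : x ∈ shell K₁ v R S
    · rw [hg, hφ, radialImage, hcol.radial_apply (hlow _ hz) hx.1,
        hcol.radial_apply (hlow _ hz1) hx.1, hcol.radial_apply (hlow _ hz2) hx.1]
      have hxt := hts (hshellT S x hx).1
      exact norm_radialImage_sub_le hε hε1 hlam0 hxt.2 hxt.1 (hh _) (hh₁ _) (hh₂ _) hηC
    · rw [hout x hx, norm_zero]; positivity
  refine ⟨φ, g, ⟨hcol.isC1HolderOn_radial (hlow _ hz) (by exact_mod_cast contDiff_infty.1 hsm 2)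
    (HasCompactSupport.intro isCompact_Icc hz) hα1 hv,
    (hcol.isCompact_shell hinf S).of_isClosed_subset (isClosed_tsupport _) hts'⟩, hφsm,
    ⟨hφ0, hsol.friedrichsGraph_radial hA hcol hv.1 hinf hsm hz⟩, ?_,
    fun x hx => (hshellT S x (hts' hx)).2⟩
  refine ENNReal.div_le_of_le_mul (hbound.trans ?_)
  have h4 : (4 : ENNReal) ^ (1 / 2 : ℝ) = 2 := by
    rw [show (4 : ENNReal) = 2 ^ (2 : ℝ) by norm_num, ← ENNReal.rpow_mul]; norm_num
  calc ν (shell K₁ v R S) ^ (1 / 2 : ℝ) * ENNReal.ofReal (Λ * ε)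
      ≤ (4 * ν D₁) ^ (1 / 2 : ℝ) * ENNReal.ofReal (Λ * ε) := by gcongr
    _ = 2 * ν D₁ ^ (1 / 2 : ℝ) * ENNReal.ofReal (Λ * ε) := by
      rw [ENNReal.mul_rpow_of_nonneg _ _ (by norm_num), h4]
    _ ≤ 2 * eLpNorm φ 2 ν * ENNReal.ofReal (Λ * ε) := by gcongr
    _ = ENNReal.ofReal (2 * Λ * ε) * eLpNorm φ 2 ν := by
      rw [mul_assoc 2 Λ ε, ENNReal.ofReal_mul zero_le_two, ENNReal.ofReal_ofNat]; ring

/-- Take `ε = 1 / (k + 1)` and let the avoided sets run through a compact exhaustion. -/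
theorem IsElliptic.exists_weyl_sequence (hA : IsElliptic ν A) (hK : IsCompact K) {α : ℝ≥0}
    (hα1 : α ≤ 1) (hv : IsC1HolderOn (n := n) α v Kᶜ) {C : ℝ} (hC : 0 < C)
    (hgrad : Tendsto (gradNorm A v) (cocompact M) (𝓝 C)) (hinf : Tendsto v (cocompact M) atTop)
    (hsol : IsWeakSolutionOn ν A Kᶜ v f) (hf : Tendsto f (cocompact M) (𝓝 0))
    (hχ : IsClassC (pushforward ν K v)) (hσ : growthRate (pushforward ν K v) = 0)
    {η : ℝ} (hη : 0 ≤ η) : ∃ φ g : ℕ → M → ℂ,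
      (∀ k, IsC1HolderOn (n := n) α (φ k) Set.univ ∧ HasCompactSupport (φ k)) ∧
      (∀ m : ℕ∞, ContMDiffOn (𝓡 n) 𝓘(ℝ, ℝ) m v Kᶜ →
        ∀ k, ContMDiff (𝓡 n) 𝓘(ℝ, ℂ) m (φ k)) ∧
      (∀ k, eLpNorm (φ k) 2 ν ≠ 0 ∧ FriedrichsGraph ν A (φ k) (g k)) ∧
      Tendsto (fun k => eLpNorm (fun x => g k x - (η : ℂ) * φ k x) 2 ν / eLpNorm (φ k) 2 ν)
        atTop (𝓝 0) ∧
      ∀ K' : Set M, IsCompact K' → ∃ N, ∀ k ≥ N, tsupport (φ k) ⊆ K'ᶜ := by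
  have : LocallyCompactSpace M := Manifold.locallyCompact_of_finiteDimensional (𝓡 n)
  obtain ⟨Λ, hΛ⟩ := hA.exists_weyl_function hK hα1 hv hC hgrad hinf hsol hf hχ hσ hη
  set E := CompactExhaustion.choice M
  choose φ g h₁ h₂ h₃ h₄ h₅ using fun k : ℕ => hΛ (1 / ((k : ℝ) + 1)) (by positivity)
    (by rw [div_le_one (by positivity)]; linarith [k.cast_nonneg (α := ℝ)]) (E k) (E.isCompact k)
  refine ⟨φ, g, h₁, fun m hm k => h₂ k m hm, h₃, ?_, fun K' hK' => ?_⟩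
  · have hlim := ENNReal.tendsto_ofReal
      ((tendsto_one_div_add_atTop_nhds_zero_nat (𝕜 := ℝ)).const_mul Λ)
    rw [mul_zero, ENNReal.ofReal_zero] at hlim
    exact tendsto_of_tendsto_of_tendsto_of_le_of_le tendsto_const_nhds hlim
      (fun k => zero_le) h₄
  · obtain ⟨N, hN⟩ := E.exists_superset_of_isCompact hK'
    exact ⟨N, fun k hk => (h₅ k).trans (Set.compl_subset_compl.2 (hN.trans (E.subset hk)))⟩

end WeylSequence

end DivForm

/-! ### The Friedrichs extension in abstract form -/

section AbstractFriedrichs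

variable {D H : Type*} [SeminormedAddCommGroup D] [InnerProductSpace ℂ D]
  [NormedAddCommGroup H] [InnerProductSpace ℂ H] [CompleteSpace H]

/-- The operator is `T = J J*`. By definition of the adjoint, `J* F` is the Riesz representative in
`V` of `ζ ↦ ⟨j ζ, F⟩`, that is, the weak solution of `(1 + L) u = F`; `J` then sends it to `H`.
Moreover `⟨T x, x⟩ = ‖J* x‖²`. Density of `e` translates statements about `V` into Cauchy sequences
in `D`, and injectivity of `J` is not needed. -/
theorem friedrichs_operator_spec {V : Type*} [NormedAddCommGroup V] [InnerProductSpace ℂ V]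
    [CompleteSpace V] {e : D → V} (hed : DenseRange e) (hei : IsUniformInducing e)
    (hein : ∀ ζ w, inner ℂ (e ζ) (e w) = inner ℂ ζ w) {j : D → H} {J : V →L[ℂ] H}
    (hJ : ∀ w, J (e w) = j w) (hJle : ‖J‖ ≤ 1) :
    ∃ T : H →L[ℂ] H, (∀ x, ∃ s : ℝ, 0 ≤ s ∧ s ≤ ‖x‖ ^ 2 ∧ inner ℂ (T x) x = (s : ℂ)) ∧
      ∀ u F : H, u = T F ↔ ∃ w : ℕ → D, CauchySeq w ∧ Tendsto (fun k => j (w k)) atTop (𝓝 u) ∧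
        ∀ ζ : D, Tendsto (fun k => inner ℂ ζ (w k)) atTop (𝓝 (inner ℂ (j ζ) F)) := by
  have hadj : ∀ x y, inner ℂ (e x) (J.adjoint y) = inner ℂ (j x) y := fun x y => by
    rw [ContinuousLinearMap.adjoint_inner_right, hJ]
  refine ⟨J.comp J.adjoint, fun x => ?_, fun u F => ⟨?_, ?_⟩⟩
  · refine ⟨‖J.adjoint x‖ ^ 2, by positivity, ?_, ?_⟩
    · have : ‖J.adjoint x‖ ≤ 1 * ‖x‖ :=
        J.adjoint.le_of_opNorm_le (by rwa [LinearIsometryEquiv.norm_map]) x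
      rw [one_mul] at this
      gcongr
    · rw [ContinuousLinearMap.comp_apply, ← ContinuousLinearMap.adjoint_inner_right,
        inner_self_eq_norm_sq_to_K]
      simp
  · intro hu
    obtain ⟨y, hy, hlim⟩ := mem_closure_iff_seq_limit.1 (hed (J.adjoint F))
    choose w hw using hy
    have hlim' : Tendsto (fun k => e (w k)) atTop (𝓝 (J.adjoint F)) :=
      hlim.congr fun k => (hw k).symm
    refine ⟨w, ?_, ?_, fun ζ => ?_⟩
    · refine hei.cauchy_map_iff.1 ?_
      rw [map_map]
      exact hlim'.cauchySeq
    · have := (J.continuous.tendsto _).comp hlim'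
      rw [hu]
      exact this.congr fun k => hJ _
    · have := (tendsto_const_nhds (x := e ζ)).inner (𝕜 := ℂ) hlim'
      rw [hadj] at this
      exact this.congr fun k => hein _ _
  · rintro ⟨w, hw, hju, hζ⟩
    have hc : CauchySeq fun k => e (w k) := by
      have := hei.cauchy_map_iff.2 hw
      rwa [map_map] at this
    obtain ⟨U, hU⟩ := cauchySeq_tendsto_of_complete hc
    have h1 : J U = u := tendsto_nhds_unique
      (((J.continuous.tendsto _).comp hU).congr fun k => hJ _) hju
    have h2 : U = J.adjoint F := by
      refine hed.eq_of_inner_right ℂ fun ζ => ?_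
      rw [hadj]
      exact tendsto_nhds_unique (((tendsto_const_nhds (x := e ζ)).inner (𝕜 := ℂ) hU).congr
        fun k => hein _ _) (hζ ζ)
    rw [← h1, h2]
    rfl

/-- The operator `T = (1 + L)⁻¹` of the Friedrichs extension `L` of a form with domain `D`,
where `D` carries the form norm and `j` is the inclusion into the Hilbert space `H`. -/
theorem exists_friedrichs_operator (j : D →ₗ[ℂ] H) (hj : ∀ w, ‖j w‖ ≤ ‖w‖) :
    ∃ T : H →L[ℂ] H, (∀ x, ∃ s : ℝ, 0 ≤ s ∧ s ≤ ‖x‖ ^ 2 ∧ inner ℂ (T x) x = (s : ℂ)) ∧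
      ∀ u F : H, u = T F ↔ ∃ w : ℕ → D, CauchySeq w ∧ Tendsto (fun k => j (w k)) atTop (𝓝 u) ∧
        ∀ ζ : D, Tendsto (fun k => inner ℂ ζ (w k)) atTop (𝓝 (inner ℂ (j ζ) F)) := by
  have hed : DenseRange (UniformSpace.Completion.toComplL (𝕜 := ℂ) (E := D)) :=
    UniformSpace.Completion.denseRange_coe
  have hei : IsUniformInducing (UniformSpace.Completion.toComplL (𝕜 := ℂ) (E := D)) :=
    UniformSpace.Completion.isUniformInducing_coe D
  have hJ := ContinuousLinearMap.extend_eq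
    (j.mkContinuous 1 fun w => by rw [one_mul]; exact hj w) hed hei
  refine friedrichs_operator_spec hed hei (fun ζ w => UniformSpace.Completion.inner_coe ζ w) hJ ?_
  refine ContinuousLinearMap.opNorm_le_bound _ zero_le_one fun x => ?_
  refine hed.induction_on (p := fun x => ‖_‖ ≤ 1 * ‖x‖) x
    (isClosed_le (by fun_prop) (by fun_prop)) fun w => ?_
  rw [hJ, one_mul]
  exact (hj w).trans (UniformSpace.Completion.norm_coe w).ge

/-- The numerical range of `T` lies in `[0, 1]`, and `1 - (1 + z) s` vanishes for some `s` in `[0,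
1]` only if `z = 1 / s - 1 ≥ 0`. By compactness it stays away from zero, and coercivity gives
invertibility. The conjugates come from the inner product being conjugate-linear in its first
argument. -/
theorem isUnit_one_sub_smul {T : H →L[ℂ] H}
    (hT : ∀ x, ∃ s : ℝ, 0 ≤ s ∧ s ≤ ‖x‖ ^ 2 ∧ inner ℂ (T x) x = (s : ℂ)) {z : ℂ}
    (hz : z ∉ (fun t : ℝ => (t : ℂ)) '' Set.Ici 0) : IsUnit (1 - (1 + z) • T) := by
  have hcont : ContinuousOn (fun s : ℝ => ‖(1 : ℂ) - starRingEnd ℂ (1 + z) * s‖) (Set.Icc 0 1) := by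
    fun_prop
  obtain ⟨s₀, hs₀, hmin⟩ := isCompact_Icc.exists_isMinOn (Set.nonempty_Icc.2 zero_le_one) hcont
  set c := ‖(1 : ℂ) - starRingEnd ℂ (1 + z) * s₀‖ with hc
  have hc0 : 0 < c := by
    rw [hc, norm_pos_iff]
    intro h0
    have h1 : (1 : ℂ) = starRingEnd ℂ (1 + z) * s₀ := sub_eq_zero.1 h0
    have h2 : (1 : ℂ) = (1 + z) * s₀ := by
      have := congrArg (starRingEnd ℂ) h1
      simpa using this
    have hs0 : s₀ ≠ 0 := fun h => by rw [h] at h2; simp at h2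
    have hpos : 0 < s₀ := lt_of_le_of_ne hs₀.1 hs0.symm
    have hsc : (s₀ : ℂ) ≠ 0 := by exact_mod_cast hs0
    refine hz ⟨s₀⁻¹ - 1, ?_, ?_⟩
    · have : 1 ≤ s₀⁻¹ := (one_le_inv₀ hpos).2 hs₀.2
      exact sub_nonneg.2 this
    · push_cast
      field_simp
      linear_combination h2
  refine ContinuousLinearMap.isUnit_of_forall_le_norm_inner_map _ (c := ⟨c, hc0.le⟩) hc0 fun x => ?_
  obtain ⟨s, hs0, hs1, hs⟩ := hT x
  rcases eq_or_ne x 0 with rfl | hx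
  · simp
  have hxn : 0 < ‖x‖ ^ 2 := by positivity
  have h1 : inner ℂ ((1 - (1 + z) • T) x) x =
      ((‖x‖ ^ 2 : ℝ) : ℂ) * (1 - starRingEnd ℂ (1 + z) * ((s / ‖x‖ ^ 2 : ℝ) : ℂ)) := by
    have hxc : ((‖x‖ : ℂ)) ≠ 0 := by exact_mod_cast norm_ne_zero_iff.2 hx
    rw [sub_apply, one_apply_eq_self, smul_apply, inner_sub_left, inner_smul_left, hs,
      inner_self_eq_norm_sq_to_K]
    push_cast
    simp only [Complex.coe_algebraMap]
    field_simp
  rw [h1, norm_mul, Complex.norm_real, Real.norm_of_nonneg hxn.le]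
  exact mul_le_mul_of_nonneg_left (hmin ⟨by positivity, (div_le_one hxn).2 hs1⟩) hxn.le

end AbstractFriedrichs

namespace DivForm

/-! ### The operator `(1 + L)⁻¹` on `L²` and the resolvent set -/

section FriedrichsOperator

variable (n : ℕ) (M : Type*) [TopologicalSpace M] [ChartedSpace (EuclideanSpace ℝ (Fin n)) M]

/-- The complex test functions, as a submodule. -/
def testSubmodule : Submodule ℂ (M → ℂ) where
  carrier := {w | IsTestFunction n Set.univ w}
  zero_mem' := ⟨contMDiff_const, HasCompactSupport.zero, Set.subset_univ _⟩
  add_mem' h₁ h₂ := ⟨h₁.1.add h₂.1, h₁.2.1.add h₂.2.1, Set.subset_univ _⟩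
  smul_mem' c w h := by
    refine ⟨?_, h.2.1.smul_left (f := fun _ => c), Set.subset_univ _⟩
    exact (ContinuousLinearMap.mul ℝ ℂ c).contDiff.contMDiff.comp h.1

/-- The complex test functions, as a type that carries no topology. -/
def TestSpace : Type _ := testSubmodule n M

instance : AddCommGroup (TestSpace n M) := inferInstanceAs (AddCommGroup (testSubmodule n M))

instance : Module ℂ (TestSpace n M) := inferInstanceAs (Module ℂ (testSubmodule n M))

variable {n M}

/-- The function underlying an element of `TestSpace`. -/
def TestSpace.toFun (w : TestSpace n M) : M → ℂ := w.1

theorem TestSpace.toFun_sub (u w : TestSpace n M) : (u - w).toFun = u.toFun - w.toFun := rfl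

theorem TestSpace.toFun_smul (c : ℂ) (w : TestSpace n M) : (c • w).toFun = c • w.toFun := rfl

/-- The real part of a test function. -/
def TestSpace.re (w : TestSpace n M) (x : M) : ℝ := (w.toFun x).re

/-- The imaginary part of a test function. -/
def TestSpace.im (w : TestSpace n M) (x : M) : ℝ := (w.toFun x).im

theorem TestSpace.re_add (u w : TestSpace n M) : (u + w).re = u.re + w.re := rfl

theorem TestSpace.im_add (u w : TestSpace n M) : (u + w).im = u.im + w.im := rfl

theorem TestSpace.re_smul (c : ℂ) (w : TestSpace n M) :
    (c • w).re = c.re • w.re + (-c.im) • w.im := by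
  ext x
  simp [TestSpace.re, TestSpace.im, TestSpace.toFun_smul]
  ring

theorem TestSpace.im_smul (c : ℂ) (w : TestSpace n M) :
    (c • w).im = c.re • w.im + c.im • w.re := by
  ext x
  simp [TestSpace.re, TestSpace.im, TestSpace.toFun_smul]

theorem TestSpace.isTestFunction_re (w : TestSpace n M) : IsTestFunction n Set.univ w.re :=
  ⟨Complex.reCLM.contDiff.contMDiff.comp w.2.1, w.2.2.1.comp_left (g := Complex.re) rfl,
    Set.subset_univ _⟩

theorem TestSpace.isTestFunction_im (w : TestSpace n M) : IsTestFunction n Set.univ w.im :=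
  ⟨Complex.imCLM.contDiff.contMDiff.comp w.2.1, w.2.2.1.comp_left (g := Complex.im) rfl,
    Set.subset_univ _⟩

/-- A real test function, as a complex one. -/
def TestSpace.ofReal {ζ : M → ℝ} (hζ : IsTestFunction n Set.univ ζ) : TestSpace n M :=
  ⟨fun x => (ζ x : ℂ), Complex.ofRealCLM.contDiff.contMDiff.comp hζ.1,
    hζ.2.1.comp_left (g := Complex.ofReal) Complex.ofReal_zero, Set.subset_univ _⟩

theorem TestSpace.re_ofReal {ζ : M → ℝ} (hζ : IsTestFunction n Set.univ ζ) :
    (TestSpace.ofReal hζ).re = ζ := rfl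

theorem TestSpace.im_ofReal {ζ : M → ℝ} (hζ : IsTestFunction n Set.univ ζ) :
    (TestSpace.ofReal hζ).im = 0 := rfl

theorem TestSpace.eq_re_add_im (w : TestSpace n M) :
    w = TestSpace.ofReal w.isTestFunction_re + Complex.I • TestSpace.ofReal w.isTestFunction_im :=
  Subtype.ext <| funext fun x => by
    change w.toFun x = ((w.toFun x).re : ℂ) + Complex.I * ((w.toFun x).im : ℂ)
    rw [mul_comm, Complex.re_add_im]

variable [MeasurableSpace M] {ν : Measure M} {A : CoeffField n M}

/-- The sesquilinear form of the complexified operator. -/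
noncomputable def sesqForm (ν : Measure M) (A : CoeffField n M) (u w : TestSpace n M) : ℂ :=
  ((form ν A u.re w.re + form ν A u.im w.im : ℝ) : ℂ) +
    Complex.I * ((form ν A u.re w.im - form ν A u.im w.re : ℝ) : ℂ)

variable [T2Space M] [SigmaCompactSpace M] [BorelSpace M] [IsManifold (𝓡 n) ∞ M]
  [IsLocallyFiniteMeasure ν]

set_option linter.unusedSectionVars false

theorem form_linear_left (hA : IsElliptic ν A) {p q w : M → ℝ}
    (hp : IsTestFunction n Set.univ p) (hq : IsTestFunction n Set.univ q)
    (hw : IsTestFunction n Set.univ w) (a b : ℝ) :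
    form ν A (a • p + b • q) w = a * form ν A p w + b * form ν A q w := by
  have h1 : ∀ {u : M → ℝ}, IsTestFunction n Set.univ u → ContMDiff (𝓡 n) 𝓘(ℝ, ℝ) 1 u :=
    fun h => h.1.of_le (by simp)
  have h2 : ∀ (c : ℝ) {u : M → ℝ}, IsTestFunction n Set.univ u →
      ContMDiff (𝓡 n) 𝓘(ℝ, ℝ) 1 (c • u) := fun c _ h =>
    (contMDiff_const (c := c) (I' := 𝓘(ℝ, ℝ))).smul (h1 h)
  rw [hA.form_comm, hA.form_add_right (h1 hw) (h2 a hp) (h2 b hq)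
    (hp.2.1.smul_left (f := fun _ => a)) (hq.2.1.smul_left (f := fun _ => b)),
    form_smul_right (h1 hp), form_smul_right (h1 hq), hA.form_comm w p, hA.form_comm w q]

theorem form_add_left (hA : IsElliptic ν A) {p q w : M → ℝ}
    (hp : IsTestFunction n Set.univ p) (hq : IsTestFunction n Set.univ q)
    (hw : IsTestFunction n Set.univ w) :
    form ν A (p + q) w = form ν A p w + form ν A q w := by
  have := form_linear_left hA hp hq hw 1 1
  rwa [one_smul, one_smul, one_mul, one_mul] at this

theorem sesqForm_conj_symm (hA : IsElliptic ν A) (u w : TestSpace n M) :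
    starRingEnd ℂ (sesqForm ν A w u) = sesqForm ν A u w := by
  rw [sesqForm, sesqForm, hA.form_comm w.re u.re, hA.form_comm w.im u.im,
    hA.form_comm w.re u.im, hA.form_comm w.im u.re]
  simp only [map_add, map_mul, Complex.conj_ofReal, Complex.conj_I]
  push_cast
  ring

theorem sesqForm_add_left (hA : IsElliptic ν A) (u₁ u₂ w : TestSpace n M) :
    sesqForm ν A (u₁ + u₂) w = sesqForm ν A u₁ w + sesqForm ν A u₂ w := by
  simp only [sesqForm, TestSpace.re_add, TestSpace.im_add]
  rw [form_add_left hA u₁.isTestFunction_re u₂.isTestFunction_re w.isTestFunction_re,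
    form_add_left hA u₁.isTestFunction_im u₂.isTestFunction_im w.isTestFunction_im,
    form_add_left hA u₁.isTestFunction_re u₂.isTestFunction_re w.isTestFunction_im,
    form_add_left hA u₁.isTestFunction_im u₂.isTestFunction_im w.isTestFunction_re]
  push_cast
  ring

theorem sesqForm_smul_left (hA : IsElliptic ν A) (u w : TestSpace n M) (c : ℂ) :
    sesqForm ν A (c • u) w = starRingEnd ℂ c * sesqForm ν A u w := by
  simp only [sesqForm, TestSpace.re_smul, TestSpace.im_smul]
  rw [form_linear_left hA u.isTestFunction_re u.isTestFunction_im w.isTestFunction_re,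
    form_linear_left hA u.isTestFunction_im u.isTestFunction_re w.isTestFunction_im,
    form_linear_left hA u.isTestFunction_re u.isTestFunction_im w.isTestFunction_im,
    form_linear_left hA u.isTestFunction_im u.isTestFunction_re w.isTestFunction_re]
  refine Complex.ext ?_ ?_ <;> simp <;> ring

theorem sesqForm_self (hA : IsElliptic ν A) (w : TestSpace n M) :
    sesqForm ν A w w = (energy ν A w.toFun : ℂ) := by
  rw [sesqForm, hA.form_comm w.re w.im, sub_self, Complex.ofReal_zero, mul_zero, add_zero]
  rfl

theorem energy_nonneg (hA : IsElliptic ν A) (u : M → ℂ) : 0 ≤ energy ν A u :=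
  add_nonneg (hA.form_self_nonneg _) (hA.form_self_nonneg _)

theorem sesqForm_ofReal (hA : IsElliptic ν A) {ζ : M → ℝ} (hζ : IsTestFunction n Set.univ ζ)
    (w : TestSpace n M) : sesqForm ν A (TestSpace.ofReal hζ) w = complexForm ν A w.toFun ζ := by
  have hz : ∀ u : M → ℝ, form ν A 0 u = 0 := fun u => by
    refine integral_eq_zero_of_ae (Eventually.of_forall fun x => ?_)
    simp [differential_eq_zero_of_notMem_tsupport (u := (0 : M → ℝ)) (x := x) (by simp [tsupport])]
  rw [sesqForm, TestSpace.re_ofReal, TestSpace.im_ofReal, hz, hz, add_zero, sub_zero,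
    hA.form_comm ζ, hA.form_comm ζ]
  rfl

theorem TestSpace.memLp (ν : Measure M) [IsLocallyFiniteMeasure ν] (w : TestSpace n M) :
    MemLp w.toFun 2 ν :=
  w.2.1.continuous.memLp_of_hasCompactSupport w.2.2.1

/-- The inclusion of the test functions in `L²`. -/
noncomputable def TestSpace.toL2 (ν : Measure M) [IsLocallyFiniteMeasure ν] : TestSpace n M →ₗ[ℂ] Lp ℂ 2 ν where
  toFun w := (w.memLp ν).toLp w.toFun
  map_add' u w := MemLp.toLp_add (u.memLp ν) (w.memLp ν)
  map_smul' c w := MemLp.toLp_const_smul c (w.memLp ν)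

theorem TestSpace.inner_toL2_ofReal {ζ : M → ℝ} (hζ : IsTestFunction n Set.univ ζ)
    (g : Lp ℂ 2 ν) :
    inner ℂ (TestSpace.toL2 ν (TestSpace.ofReal hζ)) g = ∫ x, g x * (ζ x : ℂ) ∂ν := by
  rw [L2.inner_def]
  refine integral_congr_ae ?_
  filter_upwards [((TestSpace.ofReal hζ).memLp ν).coeFn_toLp] with x hx
  have : (TestSpace.toL2 ν (TestSpace.ofReal hζ) : M → ℂ) x = (ζ x : ℂ) := hx
  rw [this, RCLike.inner_apply, Complex.conj_ofReal]

/-- The inner product of the form norm. -/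
@[reducible]
noncomputable def formCore (hA : IsElliptic ν A) : PreInnerProductSpace.Core ℂ (TestSpace n M) where
  inner u w := inner ℂ (TestSpace.toL2 ν u) (TestSpace.toL2 ν w) + sesqForm ν A u w
  conj_inner_symm u w := by
    rw [map_add, inner_conj_symm, sesqForm_conj_symm hA]
  re_inner_nonneg w := by
    rw [sesqForm_self hA, map_add]
    exact add_nonneg inner_self_nonneg (energy_nonneg hA _)
  add_left u₁ u₂ w := by
    rw [map_add, inner_add_left, sesqForm_add_left hA]; ring
  smul_left u w c := by
    rw [map_smul, inner_smul_left, sesqForm_smul_left hA]; ring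

/-- The equation `L u = g` is `(1 + L) u = u + g`, that is `u = T (u + g)`. Convergence in `L²`
together with the Cauchy property for the energy amounts to the Cauchy property in the form norm
plus an `L²` limit; the limits against test functions differ by the `L²` pairing with `u`. -/
theorem exists_friedrichsGraph_iff (hA : IsElliptic ν A) :
    ∃ T : Lp ℂ 2 ν →L[ℂ] Lp ℂ 2 ν,
      (∀ x, ∃ s : ℝ, 0 ≤ s ∧ s ≤ ‖x‖ ^ 2 ∧ inner ℂ (T x) x = (s : ℂ)) ∧
      ∀ u g : Lp ℂ 2 ν, FriedrichsGraph ν A u g ↔ u = T (u + g) := by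
  let : PreInnerProductSpace.Core ℂ (TestSpace n M) := formCore hA
  let : SeminormedAddCommGroup (TestSpace n M) :=
    InnerProductSpace.Core.toSeminormedAddCommGroup (𝕜 := ℂ)
  let : InnerProductSpace ℂ (TestSpace n M) := InnerProductSpace.ofCore (formCore hA)
  set j : TestSpace n M →ₗ[ℂ] Lp ℂ 2 ν := TestSpace.toL2 ν with hj
  have hinner : ∀ u w : TestSpace n M, inner ℂ u w = inner ℂ (j u) (j w) + sesqForm ν A u w :=
    fun _ _ => rfl
  have hnorm : ∀ w : TestSpace n M, ‖w‖ ^ 2 = ‖j w‖ ^ 2 + energy ν A w.toFun := fun w => by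
    rw [@norm_sq_eq_re_inner ℂ, hinner, sesqForm_self hA, map_add, ← @norm_sq_eq_re_inner ℂ]
    simp
  have hjle : ∀ w, ‖j w‖ ≤ ‖w‖ := fun w => by
    have h1 := hnorm w
    have h2 := energy_nonneg hA w.toFun
    exact le_of_sq_le_sq (by linarith) (norm_nonneg _)
  obtain ⟨T, hT, hTiff⟩ := exists_friedrichs_operator j hjle
  refine ⟨T, hT, fun u g => ?_⟩
  rw [hTiff]
  have htend : ∀ w : ℕ → TestSpace n M, Tendsto (fun k => eLpNorm ((w k).toFun - (u : M → ℂ)) 2 ν) atTop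
      (𝓝 0) ↔ Tendsto (fun k => j (w k)) atTop (𝓝 u) := fun w => by
    have := Lp.tendsto_Lp_iff_tendsto_eLpNorm'' (fi := atTop) (fun k => (w k).toFun) (fun k => (w k).memLp ν) u
      (Lp.memLp u)
    rw [Lp.toLp_coeFn] at this
    exact this.symm
  have hinnerR : ∀ (w : TestSpace n M) {ζ : M → ℝ} (hζ : IsTestFunction n Set.univ ζ),
      inner ℂ (TestSpace.ofReal hζ) w =
        inner ℂ (j (TestSpace.ofReal hζ)) (j w) + complexForm ν A w.toFun ζ := fun w ζ hζ => by
    rw [hinner, sesqForm_ofReal hA]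
  have hlimR : ∀ (w : ℕ → TestSpace n M), Tendsto (fun k => j (w k)) atTop (𝓝 u) →
      ∀ {ζ : M → ℝ} (hζ : IsTestFunction n Set.univ ζ),
      Tendsto (fun k => inner ℂ (j (TestSpace.ofReal hζ)) (j (w k))) atTop
        (𝓝 (inner ℂ (j (TestSpace.ofReal hζ)) u)) := fun w hw ζ hζ =>
    tendsto_const_nhds.inner hw
  constructor
  · rintro ⟨-, -, w, ⟨hw, hwu, hwc⟩, hlim⟩
    set w' : ℕ → TestSpace n M := fun k => ⟨w k, hw k⟩ with hw'
    have hju : Tendsto (fun k => j (w' k)) atTop (𝓝 u) := (htend w').1 hwu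
    have hR : ∀ {ζ : M → ℝ} (hζ : IsTestFunction n Set.univ ζ),
        Tendsto (fun k => inner ℂ (TestSpace.ofReal hζ) (w' k)) atTop
          (𝓝 (inner ℂ (j (TestSpace.ofReal hζ)) (u + g))) := fun {ζ} hζ => by
      rw [inner_add_right, hj, TestSpace.inner_toL2_ofReal hζ g, ← hj]
      exact ((hlimR w' hju hζ).add (hlim ζ hζ)).congr fun k => (hinnerR (w' k) hζ).symm
    refine ⟨w', ?_, hju, fun ζ => ?_⟩
    · rw [Metric.cauchySeq_iff]
      intro ε hε
      obtain ⟨N₁, h₁⟩ := Metric.cauchySeq_iff.1 hju.cauchySeq (ε / 2) (by positivity)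
      -- The squared form norm is then below `ε² / 4 + ε² / 2 < ε²`.
      obtain ⟨N₂, h₂⟩ := hwc (ε ^ 2 / 2) (by positivity)
      refine ⟨max N₁ N₂, fun k hk l hl => ?_⟩
      have h3 := h₁ k (le_of_max_le_left hk) l (le_of_max_le_left hl)
      have h4 := h₂ k (le_of_max_le_right hk) l (le_of_max_le_right hl)
      rw [dist_eq_norm, ← map_sub] at h3
      rw [dist_eq_norm]
      have h5 := hnorm (w' k - w' l)
      have h6 : energy ν A (w' k - w' l).toFun < ε ^ 2 / 2 := h4
      have h7 : ‖j (w' k - w' l)‖ ^ 2 < (ε / 2) ^ 2 := by gcongr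
      refine lt_of_pow_lt_pow_left₀ 2 hε.le ?_
      nlinarith [sq_nonneg ε]
    -- The graph tests with real functions only; a complex `ζ` is split into real and imaginary
    -- parts.
    · have hp := hR ζ.isTestFunction_re
      have hq := hR ζ.isTestFunction_im
      have hζ := ζ.eq_re_add_im
      generalize TestSpace.ofReal ζ.isTestFunction_re = p at hp hζ
      generalize TestSpace.ofReal ζ.isTestFunction_im = q at hq hζ
      rw [hζ]
      simp only [map_add, map_smul, inner_add_left, inner_smul_left]
      exact hp.add (hq.const_mul _)
  · rintro ⟨w, hwc, hju, hlim⟩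
    refine ⟨Lp.memLp u, Lp.memLp g, fun k => (w k).toFun,
      ⟨fun k => (w k).2, (htend w).2 hju, fun ε hε => ?_⟩, fun ζ hζ => ?_⟩
    · obtain ⟨N, hN⟩ := Metric.cauchySeq_iff.1 hwc (√ε) (Real.sqrt_pos.2 hε)
      refine ⟨N, fun k hk l hl => ?_⟩
      have h1 := hN k hk l hl
      rw [dist_eq_norm] at h1
      have h2 := hnorm (w k - w l)
      have h3 : ‖w k - w l‖ ^ 2 < √ε ^ 2 := by gcongr
      rw [Real.sq_sqrt hε.le] at h3
      rw [← TestSpace.toFun_sub]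
      nlinarith [sq_nonneg ‖j (w k - w l)‖]
    · have h1 := (hlim (TestSpace.ofReal hζ)).sub (hlimR w hju hζ)
      rw [inner_add_right, add_sub_cancel_left, hj, TestSpace.inner_toL2_ofReal hζ g, ← hj] at h1
      refine h1.congr fun k => ?_
      rw [hinnerR, add_sub_cancel_left]

/-- The equation `(L - z) u = f` reads `u = T (f + (1 + z) u)`, that is `(1 - (1 + z) T) u = T f`.
So the resolvent is `B⁻¹ T` with `B = 1 - (1 + z) T`. -/
theorem mem_resolventSet (hA : IsElliptic ν A) {z : ℂ}
    (hz : z ∉ (fun t : ℝ => (t : ℂ)) '' Set.Ici 0) : z ∈ resolventSet ν A := by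
  obtain ⟨T, hT, hiff⟩ := exists_friedrichsGraph_iff hA
  obtain ⟨B, hB⟩ := isUnit_one_sub_smul hT hz
  have happ : ∀ x, (B : Lp ℂ 2 ν →L[ℂ] Lp ℂ 2 ν) x = x - (1 + z) • T x := fun x => by
    rw [hB, sub_apply, one_apply_eq_self, smul_apply]
  have hBi : ∀ x, (B : Lp ℂ 2 ν →L[ℂ] Lp ℂ 2 ν) ((↑B⁻¹ : Lp ℂ 2 ν →L[ℂ] Lp ℂ 2 ν) x) = x :=
    fun x => by rw [← mul_apply_eq_comp, B.mul_inv, one_apply_eq_self]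
  have hiB : ∀ x, (↑B⁻¹ : Lp ℂ 2 ν →L[ℂ] Lp ℂ 2 ν) ((B : Lp ℂ 2 ν →L[ℂ] Lp ℂ 2 ν) x) = x :=
    fun x => by rw [← mul_apply_eq_comp, B.inv_mul, one_apply_eq_self]
  refine ⟨(↑B⁻¹ : Lp ℂ 2 ν →L[ℂ] Lp ℂ 2 ν).comp T, fun f => ?_, fun u g hug => ?_⟩
  · rw [hiff, ContinuousLinearMap.comp_apply]
    set y := (↑B⁻¹ : Lp ℂ 2 ν →L[ℂ] Lp ℂ 2 ν) (T f) with hy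
    have h1 := hBi (T f)
    rw [← hy, happ, sub_eq_iff_eq_add] at h1
    conv_lhs => rw [h1]
    rw [map_add, map_add, map_smul]
    module
  · rw [hiff] at hug
    rw [ContinuousLinearMap.comp_apply]
    conv_rhs => rw [← hiB u]
    congr 1
    rw [happ, map_sub, map_smul]
    conv_rhs => enter [1]; rw [hug]
    rw [map_add]
    module

end FriedrichsOperator

/-! ### Weyl's criterion -/

section Spectrum

variable {n : ℕ} {M : Type*} [TopologicalSpace M] [ChartedSpace (EuclideanSpace ℝ (Fin n)) M]
  [MeasurableSpace M] {ν : Measure M} {A : CoeffField n M}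

/-- The graph depends only on a.e. classes. This matters because the Weyl functions are genuine
functions while the resolvent acts on `Lp`. -/
theorem FriedrichsGraph.toLp {u g : M → ℂ} (h : FriedrichsGraph ν A u g) :
    FriedrichsGraph ν A (h.1.toLp u) (h.2.1.toLp g) := by
  obtain ⟨w, ⟨hw, hwu, hwc⟩, hlim⟩ := h.2.2
  refine ⟨Lp.memLp _, Lp.memLp _, w, ⟨hw, hwu.congr fun k => ?_, hwc⟩, fun ζ hζ => ?_⟩
  · refine eLpNorm_congr_ae ?_
    filter_upwards [h.1.coeFn_toLp] with x hx
    rw [Pi.sub_apply, Pi.sub_apply, hx]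
  · convert hlim ζ hζ using 2
    refine integral_congr_ae ?_
    filter_upwards [h.2.1.coeFn_toLp] with x hx
    rw [hx]

theorem exists_eLpNorm_le_of_mem_resolventSet {z : ℂ} (hz : z ∈ resolventSet ν A) :
    ∃ c : ℝ≥0, ∀ u g : M → ℂ, FriedrichsGraph ν A u g →
      eLpNorm u 2 ν ≤ c * eLpNorm (fun x => g x - z * u x) 2 ν := by
  obtain ⟨R, -, hR⟩ := hz
  refine ⟨‖R‖₊, fun u g h => ?_⟩
  have h1 := R.le_opNNNorm (h.2.1.toLp g - z • h.1.toLp u)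
  rw [hR _ _ h.toLp, ← MemLp.toLp_const_smul, ← MemLp.toLp_sub] at h1
  have h2 := ENNReal.coe_le_coe.2 h1
  rw [ENNReal.coe_mul] at h2
  simp only [← enorm_eq_nnnorm, Lp.enorm_toLp] at h2
  exact h2

/-- A bounded inverse would give `‖φ k‖ ≤ c ‖(L - z) φ k‖`, so `1` would be bounded by `c` times
ratios tending to zero. The norms of `φ k` are nonzero and finite, which permits the division. -/
theorem notMem_resolventSet_of_tendsto {z : ℂ} {φ g : ℕ → M → ℂ}
    (hφ : ∀ k, eLpNorm (φ k) 2 ν ≠ 0 ∧ FriedrichsGraph ν A (φ k) (g k))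
    (hlim : Tendsto (fun k => eLpNorm (fun x => g k x - z * φ k x) 2 ν / eLpNorm (φ k) 2 ν)
      atTop (𝓝 0)) : z ∉ resolventSet ν A := by
  intro hz
  obtain ⟨c, hc⟩ := exists_eLpNorm_le_of_mem_resolventSet hz
  have hlim' := ENNReal.Tendsto.const_mul (a := (c : ENNReal)) hlim (Or.inr ENNReal.coe_ne_top)
  rw [mul_zero] at hlim'
  refine absurd (ge_of_tendsto' hlim' fun k => ?_) (not_le.2 zero_lt_one)
  rw [← mul_div_assoc, ENNReal.le_div_iff_mul_le (Or.inl (hφ k).1) (Or.inl (hφ k).2.1.2.ne),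
    one_mul]
  exact hc _ _ (hφ k).2

end Spectrum

end DivForm

theorem proposition2p8 {n : ℕ} (hn : 2 ≤ n) {M : Type*} [TopologicalSpace M] [T2Space M]
    [SigmaCompactSpace M] [ConnectedSpace M] [ChartedSpace (EuclideanSpace ℝ (Fin n)) M]
    [IsManifold 𝓘(ℝ, EuclideanSpace ℝ (Fin n)) ∞ M] [MeasurableSpace M] [BorelSpace M]
    (ν : Measure M) (hν : DivForm.HasLocallyBoundedDensity (n := n) ν)
    (A : DivForm.CoeffField n M) (hA : DivForm.IsElliptic ν A)
    (K : Set M) (hK : IsCompact K) (α : ℝ≥0) (hα0 : 0 < α) (hα1 : α < 1)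
    (v : M → ℝ) (hv : DivForm.IsC1HolderOn (n := n) α v Kᶜ)
    (C : ℝ) (hC : 0 < C) (hgrad : Tendsto (DivForm.gradNorm A v) (cocompact M) (𝓝 C))
    (hinf : Tendsto v (cocompact M) atTop)
    (hLv : ∃ f : M → ℝ, DivForm.IsWeakSolutionOn ν A Kᶜ v f ∧ Tendsto f (cocompact M) (𝓝 0))
    (hχ : DivForm.IsClassC (DivForm.pushforward ν K v))
    (hσ : DivForm.growthRate (DivForm.pushforward ν K v) = 0) :
    DivForm.spectrum ν A = (fun t : ℝ => (t : ℂ)) '' Set.Ici 0 ∧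
    ∀ η : ℝ, 0 ≤ η → ∃ φ g : ℕ → M → ℂ,
      (∀ k, DivForm.IsC1HolderOn (n := n) α (φ k) Set.univ ∧ HasCompactSupport (φ k)) ∧
      (∀ m : ℕ∞, ContMDiffOn 𝓘(ℝ, EuclideanSpace ℝ (Fin n)) 𝓘(ℝ, ℝ) m v Kᶜ →
        ∀ k, ContMDiff 𝓘(ℝ, EuclideanSpace ℝ (Fin n)) 𝓘(ℝ, ℂ) m (φ k)) ∧
      (∀ k, eLpNorm (φ k) 2 ν ≠ 0 ∧ DivForm.FriedrichsGraph ν A (φ k) (g k)) ∧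
      Tendsto (fun k => eLpNorm (fun x => g k x - (η : ℂ) * φ k x) 2 ν / eLpNorm (φ k) 2 ν)
        atTop (𝓝 0) ∧
      ∀ K' : Set M, IsCompact K' → ∃ N, ∀ k ≥ N, tsupport (φ k) ⊆ K'ᶜ := by
  have := hν.isLocallyFiniteMeasure
  obtain ⟨f, hsol, hf⟩ := hLv
  have hweyl := fun (η : ℝ) (hη : 0 ≤ η) =>
    hA.exists_weyl_sequence hK hα1.le hv hC hgrad hinf hsol hf hχ hσ hη
  refine ⟨Set.Subset.antisymm
    (fun z hz => by_contra fun h => hz (DivForm.mem_resolventSet hA h)) ?_, hweyl⟩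
  rintro _ ⟨t, ht, rfl⟩
  obtain ⟨φ, g, -, -, hφ, hlim, -⟩ := hweyl t ht
  exact DivForm.notMem_resolventSet_of_tendsto hφ hlim
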